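/- \textbf{Setting.} Let $\mathcal G$ be a finite trivalent graph giving a cell decomposition of a compact oriented surface with boundary: every vertex (also on the boundary) is trivalent, the boundary circles are disjoint simple cycles of $\mathcal G$, no face borders itself along an edge, every face has at most one boundary edge, and no two boundary vertices are joined to the same vertex off the boundary. Every face $p$ (plaquette) carries an Ising spin $\tau^z_p=\pm1$, and every edge $l$ of $\mathcal G$ not on the boundary carries a complex fermion $c_l$. Blow up each vertex off the boundary into a triangle to obtain $\mathcal G'$, and fix a Kasteleyn orientation of $\mathcal G'$ (an odd number of clockwise edges around each plaquette and each triangle); put $s_{xy}=1$ if the edge $xy$ is oriented from $x$ to $y$ and $s_{xy}=-1$ otherwise. For a non-boundary edge $l$ of $\mathcal G$, oriented from $x$ to $y$, there are Majoranas $\gamma_x=c_l+c_l^\dagger$, $\gamma_y=i(c_l^\dagger-c_l)$ at its two ends. A triangle has the majority spin of its three neighbouring plaquettes. For a spin configuration $c$ let $\mathcal D(c)$ be the dimer cover which contains a non-boundary edge inherited from $\mathcal G$ iff the two faces bordering it have equal spins, a triangle edge iff the two faces bordering it have opposite spins, and no boundary edge. A Majorana is paired in $c$ if it is covered by $\mathcal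 D(c)$, and unpaired otherwise; it is paired (unpaired) in a state if it is so in all spin configurations occurring in the state. Let $\mathcal V^c$ be the space of states with $i s_{xy}\gamma_x\gamma_y=1$ on every dimer $xy$ of the spin configuration. Let $c_p$ be $c$ with the spin of $p$ flipped. The plaquette flip operator is $$F_p=\sum_c N_{p,c}\,\Pi_{p,c}\otimes \tau^x_pP_c,\qquad \Pi_{p,c}=\prod_{xy\in\mathcal D(c_p)\setminus\mathcal D(c)}\tfrac12\,(1+i s_{xy}\gamma_x\gamma_y),\qquad N_{p,c}=2^{(n-1)/2},$$ where $P_c$ is the projector onto the spin configuration $c$ and the symmetric difference of $\mathcal D(c)$ and $\mathcal D(c_p)$ is a closed loop with $2n$ Majoranas or an open string with $2n$ or $2n-1$ Majoranas. \textbf{Proposition 3.} Going around a boundary circle with the surface on the right, let $i-1,i,i+1,i+2$ be consecutive boundary plaquettes, and let $\gamma_{k,k+1}$ be the boundary Majorana shared by the boundary plaquettes $k$ and $k+1$. Let $|\psi\rangle\in\mathcal V^c$ be a state in which $\gamma_{i,i+1}$ is paired (i.e. the plaquettes $i$ and $i+1$ have the same spin). Then: \begin{itemize} \item if $\gamma_{i-1,i}$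 and $\gamma_{i+1,i+2}$ are both paired, $F_iF_{i+1}|\psi\rangle=F_{i+1}F_i|\psi\rangle$; \item if $\gamma_{i-1,i}$ and $\gamma_{i+1,i+2}$ are both unpaired, $F_iF_{i+1}|\psi\rangle=F_{i+1}F_i|\psi\rangle$; \item if $\gamma_{i-1,i}$ is unpaired and $\gamma_{i+1,i+2}$ is paired, $F_iF_{i+1}|\psi\rangle=\frac1{\sqrt2}F_{i+1}F_i|\psi\rangle$; \item if $\gamma_{i-1,i}$ is paired and $\gamma_{i+1,i+2}$ is unpaired, $F_{i+1}F_i|\psi\rangle=\frac1{\sqrt2}F_iF_{i+1}|\psi\rangle$. \end{itemize} Moreover the factor comes from the normalization constants only. For every spin configuration $c$ occurring in $|\psi\rangle$, with component $|\psi_c\rangle$ in the fermion space, $\Pi_{i,c_{i+1}}\Pi_{i+1,c}|\psi_c\rangle=\Pi_{i+1,c_i}\Pi_{i,c}|\psi_c\rangle$, and the ratio $N_{i,c_{i+1}}N_{i+1,c}/(N_{i+1,c_i}N_{i,c})$ equals $1,\,1,\,1/\sqrt2,\,\sqrt2$ in the four cases, respectively. -/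

import Mathlib

/-- A finite trivalent graph embedded in a closed oriented surface with disc faces, given by its
darts (oriented edges). `rot d` is the next dart counterclockwise around the tail of `d`, and
`rev d` is the same edge with the opposite direction. -/
structure TrivalentMap (D : Type*) where
  rot : Equiv.Perm D
  rev : Equiv.Perm D
  rot_three : ∀ d, rot (rot (rot d)) = d
  rot_ne : ∀ d, rot d ≠ d
  rev_rev : ∀ d, rev (rev d) = d
  rev_ne : ∀ d, rev d ≠ d

namespace TrivalentMap

variable {D : Type*} (G : TrivalentMap D)

/-- The next dart along the face to the left of a dart. -/
def next : Equiv.Perm D := G.rev.trans G.rot.symm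

/-- Faces are the orbits of `next`. -/
def Face : Type _ := Quotient (Equiv.Perm.SameCycle.setoid G.next)

/-- The face to the left of `d`; it is also the face in the corner between `d` and `rot d`. -/
def left (d : D) : G.Face := Quotient.mk (Equiv.Perm.SameCycle.setoid G.next) d

theorem left_next (d : D) : G.left (G.next d) = G.left d :=
  Quotient.sound (s := Equiv.Perm.SameCycle.setoid G.next)
    ((Equiv.Perm.sameCycle_apply_left (f := G.next)).2 (Equiv.Perm.SameCycle.refl _ d))

/-- The face to the right of `d` is the one in the corner just before `d`. -/
theorem left_rev (d : D) : G.left (G.rev d) = G.left (G.rot (G.rot d)) := by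
  rw [← G.left_next (G.rev d)]
  congr 1
  simp [next, G.rev_rev, Equiv.symm_apply_eq, G.rot_three]

end TrivalentMap

/-- A trivalent cell decomposition `𝒢` of a compact oriented surface with boundary. The boundary
circles are the contours of the faces in `hole`, which are not part of the surface. -/
structure OpenCellulation (D : Type*) extends TrivalentMap D where
  hole : Set toTrivalentMap.Face
  /-- The boundary circles are simple and disjoint: at most one of the three corners at a vertex
  lies in a hole. -/
  hole_corner : ∀ d, toTrivalentMap.left d ∈ hole → toTrivalentMap.left (rot d) ∉ hole
  /-- No face borders itself. -/
  left_rev_ne : ∀ d, toTrivalentMap.left (rev d) ≠ toTrivalentMap.left d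
  /-- A face has at most one boundary edge. -/
  boundary_edge_unique : ∀ d d', toTrivalentMap.left (rev d) ∈ hole →
    toTrivalentMap.left (rev d') ∈ hole → toTrivalentMap.left d = toTrivalentMap.left d' → d = d'
  /-- No two boundary vertices connect to the same vertex. If the corner at `d` lies in a hole,
  then `rot (rot d)` is the edge that leaves the boundary. -/
  boundary_neighbor_unique : ∀ d d', toTrivalentMap.left d ∈ hole → toTrivalentMap.left d' ∈ hole →
    rot.SameCycle (rev (rot (rot d))) (rev (rot (rot d'))) → d = d'

namespace OpenCellulation

variable {D : Type*} (M : OpenCellulation D)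

/-- The plaquettes, which carry the Ising spins. -/
def Plaquette : Type _ := {f : M.Face // f ∉ M.hole}

/-- The edge of `d` is not on the boundary. -/
def Inner (d : D) : Prop := M.left d ∉ M.hole ∧ M.left (M.rev d) ∉ M.hole

/-- The tail of `d` is not on the boundary. -/
def BulkVertex (d : D) : Prop :=
  M.left d ∉ M.hole ∧ M.left (M.rot d) ∉ M.hole ∧ M.left (M.rot (M.rot d)) ∉ M.hole

variable {M}

theorem Inner.rev {d : D} (h : M.Inner d) : M.Inner (M.rev d) :=
  ⟨h.2, by rw [M.rev_rev]; exact h.1⟩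

theorem BulkVertex.rot {d : D} (h : M.BulkVertex d) : M.BulkVertex (M.rot d) :=
  ⟨h.2.1, h.2.2, by rw [M.rot_three]; exact h.1⟩

theorem BulkVertex.inner {d : D} (h : M.BulkVertex d) : M.Inner d :=
  ⟨h.1, by rw [M.left_rev]; exact h.2.2⟩

variable (M)

/-- The Majoranas, i.e. the vertices of the graph `𝒢'` in which the vertices off the boundary are
blown up into triangles. The Majorana of the dart `d` sits on the edge of `d` near its tail, so a
vertex off the boundary has three Majoranas, and a boundary vertex has one. -/
def Majorana : Type _ := {d : D // M.Inner d}

/-- The boundary edges, as darts with the vacuum on the left and the surface on the right. -/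
def BoundaryEdge : Type _ := {d : D // M.left d ∈ M.hole}

namespace BoundaryEdge

variable {M}

/-- The boundary plaquette `i` that contains a boundary edge. -/
def plaquette (b : M.BoundaryEdge) : M.Plaquette :=
  ⟨M.left (M.rev b.1), fun h => by
    rw [M.left_rev] at h
    have := M.hole_corner _ h
    rw [M.rot_three] at this
    exact this b.2⟩

/-- The following boundary edge, which belongs to the boundary plaquette `i + 1`. -/
def succ (b : M.BoundaryEdge) : M.BoundaryEdge :=
  ⟨M.next b.1, by rw [M.left_next]; exact b.2⟩

/-- The boundary Majorana `γ_{i-1,i}` at the tail of a boundary edge of plaquette `i`. -/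
def tail (b : M.BoundaryEdge) : M.Majorana :=
  ⟨M.rot (M.rot b.1), b.plaquette.2 ∘ fun h => by
      change M.left (M.rev b.1) ∈ M.hole
      rw [M.left_rev]; exact h,
    fun h => by
      rw [M.left_rev, M.rot_three] at h
      exact M.hole_corner _ b.2 h⟩

/-- The boundary Majorana `γ_{i,i+1}` at the head of a boundary edge of plaquette `i`. -/
def head (b : M.BoundaryEdge) : M.Majorana := b.succ.tail

end BoundaryEdge

/-- A Kasteleyn orientation of `𝒢'`. `along d` says that the edge inherited from the edge of `d`
is oriented in the direction of `d`; `turn d` says that the triangle edge between the Majoranas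
`d` and `rot d` is oriented from `d` to `rot d`. (`turn` is meaningless at boundary vertices, which
are not blown up.) Around every triangle and every plaquette the number of clockwise edges is odd:
going counterclockwise, a triangle is traversed from `d` to `rot d`, while the plaquette on the
left of `d` is traversed in the direction of `d` and, in its corner, from `rot d` to `d`. -/
structure KasteleynOrientation where
  along : D → Bool
  along_rev : ∀ d, along (M.rev d) = !along d
  turn : D → Bool
  triangle_odd : ∀ d, M.BulkVertex d →
    Odd (Set.ncard {e | e ∈ ({d, M.rot d, M.rot (M.rot d)} : Set D) ∧ turn e = false})
  plaquette_odd : ∀ p : M.Plaquette,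
    Odd (Set.ncard {d | M.left d = p.1 ∧ along d = false} +
      Set.ncard {d | M.left d = p.1 ∧ M.BulkVertex d ∧ turn d = true})

/-- Ising spin configurations. -/
abbrev Config : Type _ := M.Plaquette → Bool

namespace Config

variable {M}

open scoped Classical in
/-- The configuration `c_p` in which the spin of `p` is flipped. -/
noncomputable def flip (p : M.Plaquette) (c : M.Config) : M.Config :=
  Function.update c p (!c p)

/-- Majority rule for the spin of a triangle. -/
def majority (x y z : Bool) : Bool := (x && y) || (y && z) || (z && x)

/-- The spin of the triangle at the tail of `d`. -/
def triangleSpin (c : M.Config) (d : D) (h : M.BulkVertex d) : Bool :=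
  majority (c ⟨M.left d, h.1⟩) (c ⟨M.left (M.rot d), h.2.1⟩) (c ⟨M.left (M.rot (M.rot d)), h.2.2⟩)

end Config

namespace KasteleynOrientation

variable {M} (o : M.KasteleynOrientation)

/-- The type I edges: the non-boundary edges of `𝒢`, each represented by the dart that agrees with
the orientation. Each of them carries a complex fermion. -/
def TypeI : Type _ := {d : D // M.Inner d ∧ o.along d = true}

/-- The edges of `𝒢'` that are not on the boundary: type I edges and type II (triangle) edges; the
latter join `d` and `rot d`, where `d` is a dart at a vertex off the boundary. -/
inductive Edge : Type _
  | typeI (l : o.TypeI) : Edge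
  | typeII (d : D) (h : M.BulkVertex d) : Edge

/-- First end of an edge. -/
def Edge.fst {o : M.KasteleynOrientation} : o.Edge → M.Majorana
  | .typeI l => ⟨l.1, l.2.1⟩
  | .typeII d h => ⟨d, h.inner⟩

/-- Second end of an edge. -/
def Edge.snd {o : M.KasteleynOrientation} : o.Edge → M.Majorana
  | .typeI l => ⟨M.rev l.1, l.2.1.rev⟩
  | .typeII d h => ⟨M.rot d, h.rot.inner⟩

/-- The sign `s` of an edge: `1` if it is oriented from its first to its second end, `-1`
otherwise. -/
def Edge.sign {o : M.KasteleynOrientation} : o.Edge → ℂ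
  | .typeI _ => 1
  | .typeII d _ => if o.turn d then 1 else -1

/-- The dimer cover `𝒟(c)`: a type I edge is covered if the two faces bordering it have the same
spin, a type II edge (between a plaquette and a triangle) if they have opposite spins. -/
def dimers (c : M.Config) : Set o.Edge :=
  {e | match e with
    | .typeI l => c ⟨M.left l.1, l.2.1.1⟩ = c ⟨M.left (M.rev l.1), l.2.1.2⟩
    | .typeII d h => c ⟨M.left d, h.1⟩ ≠ c.triangleSpin d h}

/-- The Majorana `x` is covered by a dimer of `𝒟(c)`. -/
def Covered (c : M.Config) (x : M.Majorana) : Prop :=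
  ∃ e ∈ o.dimers c, e.fst = x ∨ e.snd = x

/-- The fermionic Fock space with one mode on every type I edge. -/
abbrev Fock : Type _ := ExteriorAlgebra ℂ (o.TypeI → ℂ)

open scoped Classical in
/-- The creation operator of the mode `l`. -/
noncomputable def create (l : o.TypeI) : Module.End ℂ o.Fock :=
  LinearMap.mulLeft ℂ (ExteriorAlgebra.ι ℂ (Pi.single l 1))

/-- The annihilation operator of the mode `l`. -/
noncomputable def annihilate (l : o.TypeI) : Module.End ℂ o.Fock :=
  CliffordAlgebra.contractLeft (LinearMap.proj l : (o.TypeI → ℂ) →ₗ[ℂ] ℂ)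

/-- The Majorana operators: `γ_x = c_l + c_l†` and `γ_y = i (c_l† - c_l)` for a type I edge `l`
oriented from `x` to `y`. -/
noncomputable def γ (x : M.Majorana) : Module.End ℂ o.Fock :=
  if h : o.along x.1 = true then
    o.annihilate ⟨x.1, x.2, h⟩ + o.create ⟨x.1, x.2, h⟩
  else
    have h' : o.along (M.rev x.1) = true := by rw [o.along_rev]; simpa using h
    Complex.I • (o.create ⟨M.rev x.1, x.2.rev, h'⟩ - o.annihilate ⟨M.rev x.1, x.2.rev, h'⟩)

/-- The fermion parity `i s_{xy} γ_x γ_y` of an edge `xy`. -/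
noncomputable def parity (e : o.Edge) : Module.End ℂ o.Fock :=
  (Complex.I * e.sign) • (o.γ e.fst * o.γ e.snd)

/-- The projector `P_{xy} = (1 + i s_{xy} γ_x γ_y) / 2`. -/
noncomputable def proj (e : o.Edge) : Module.End ℂ o.Fock :=
  (1 / 2 : ℂ) • (1 + o.parity e)

/-- States `∑_c ψ(c) ⊗ |c⟩` of the Majoranas and the spins. -/
abbrev State : Type _ := M.Config → o.Fock

/-- The subspace `𝒱ᶜ` of the states whose Majoranas conform to the dimer cover. -/
def constrained : Submodule ℂ o.State where
  carrier := {ψ | ∀ c, ∀ e ∈ o.dimers c, o.parity e (ψ c) = ψ c}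
  add_mem' := fun ha hb c e he => by simp [ha c e he, hb c e he]
  zero_mem' := fun c e _ => by simp
  smul_mem' := fun r a ha c e he => by simp [ha c e he]

/-- In the state `ψ` the Majorana `x` is paired. -/
def Paired (ψ : o.State) (x : M.Majorana) : Prop := ∀ c, ψ c ≠ 0 → o.Covered c x

/-- In the state `ψ` the Majorana `x` is unpaired. -/
def Unpaired (ψ : o.State) (x : M.Majorana) : Prop := ∀ c, ψ c ≠ 0 → ¬ o.Covered c x

/-- The number of Majoranas on the closed loop or open string `𝒟(c) + 𝒟(c_p)`. -/
noncomputable def stringLength (p : M.Plaquette) (c : M.Config) : ℕ :=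
  Set.ncard {x : M.Majorana |
    ∃ e ∈ symmDiff (o.dimers c) (o.dimers (c.flip p)), e.fst = x ∨ e.snd = x}

/-- The normalization `N_{p,c} = 2 ^ ((n - 1) / 2)`, where the closed loop has `2 n` Majoranas and
the open string has `2 n` or `2 n - 1` Majoranas. -/
noncomputable def normalization (p : M.Plaquette) (c : M.Config) : ℝ :=
  (2 : ℝ) ^ (((((o.stringLength p c + 1) / 2 : ℕ) : ℝ) - 1) / 2)

section

variable [Fintype D]

instance : Finite M.Plaquette :=
  have : Finite M.Face := inferInstanceAs (Finite (Quotient _))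
  inferInstanceAs (Finite {f : M.Face // f ∉ M.hole})

instance : Finite o.Edge := by
  have : Finite o.TypeI := inferInstanceAs (Finite {d : D // M.Inner d ∧ o.along d = true})
  refine Finite.of_injective
    (fun e : o.Edge => match e with
      | .typeI l => (Sum.inl l : o.TypeI ⊕ {d : D // M.BulkVertex d})
      | .typeII d h => Sum.inr ⟨d, h⟩) ?_
  rintro (l | ⟨d, h⟩) (l' | ⟨d', h'⟩) hh <;> simp_all

/-- The product `Π_{p,c}` of the projectors onto the new dimers, i.e. those of `𝒟(c_p)` on the loop
or string `𝒟(c) + 𝒟(c_p)`. The dimers of `𝒟(c_p)` are disjoint, so the factors commute and their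
order does not matter. -/
noncomputable def flipProj (p : M.Plaquette) (c : M.Config) : Module.End ℂ o.Fock :=
  ((Set.toFinite (o.dimers (c.flip p) \ o.dimers c)).toFinset.toList.map o.proj).prod

/-- The fermionic factor `X_{p,c}` of the plaquette flip operator. -/
noncomputable def flipFactor (p : M.Plaquette) (c : M.Config) : Module.End ℂ o.Fock :=
  (o.normalization p c : ℂ) • o.flipProj p c

open scoped Classical in
/-- The plaquette flip operator `F_p = ∑_c X_{p,c} ⊗ τˣ_p P_c`, where `τˣ_p P_c = |c_p⟩⟨c|`. -/
noncomputable def F (p : M.Plaquette) : Module.End ℂ o.State :=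
  haveI : Fintype M.Plaquette := Fintype.ofFinite _
  ∑ c : M.Config, LinearMap.single ℂ (fun _ : M.Config => o.Fock) (c.flip p) ∘ₗ
    o.flipFactor p c ∘ₗ LinearMap.proj c

/-- The ratio of the normalization constants of `F_p F_q` and `F_q F_p` on the configuration
`c`. -/
noncomputable def normRatio (p q : M.Plaquette) (c : M.Config) : ℝ :=
  (o.normalization p (c.flip q) * o.normalization q c) / (o.normalization q (c.flip p) * o.normalization p c)

end

end KasteleynOrientation

end OpenCellulation

/-! ### Faces at a vertex, spins, and disjointness of the dimers. -/

namespace OpenCellulation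

variable {D : Type*} {M : OpenCellulation D}

/-! Let p and q be the two plaquettes, with equal spins in c, and let v conform to c. After the
first flip the state conforms to the new cover, so the second flip acts as the projector L onto all
dimers of the doubly flipped configuration (`flipProj_apply_eq_dimerProj`). Both orders end in the
same L, and it remains to compare L Π_{p,c} v with L Π_{q,c} v.

L absorbs every factor whose dimer is still present at the end. The surviving factors belong to
triangle dimers at the ends of the edges shared by p and q (`exists_minorEdge`, `mul_flipProj`). A
shared edge is itself a dimer both in c and at the end, so its parity is 1 on v and under L, while
the parity of a triangle dimer at one of its ends anticommutes with it. Hence in the expanded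
product the terms with a single such parity vanish. If an end lies on the boundary, nothing but the
constant term is left. Otherwise the product of the parities at the two ends also remains. At each
end the triangle dimers of the two orders are two sides of a triangle whose third side is a dimer of
c or of the final configuration, so the Kasteleyn relation exchanges them at the price of a phase i
(`minorEdge_transfer`). From the other end p and q appear interchanged, so the two phases cancel
(`endEdges_transfer`). This gives `flipProj_flipProj` for any two distinct plaquettes of equal spin.

As to the normalization, the two string lengths have the same sum in both orders
(`stringLength_flip`), but each constant depends on half a length rounded up, so the ratio is
decided by parities. Counting domain walls around a boundary plaquette shows that its string has
even length iff its two neighbours along the boundary have equal spins (`even_stringLength_iff`).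
Flipping one neighbour reverses this, except on a circle with two plaquettes, and
`normRatio_boundary` reads off the four cases. -/

theorem left_rot_rot_ne (d : D) : M.left (M.rot (M.rot d)) ≠ M.left d := by
  rw [← M.left_rev]; exact M.left_rev_ne d

theorem left_rot_ne (d : D) : M.left (M.rot d) ≠ M.left d := by
  have := left_rot_rot_ne (M := M) (M.rot d)
  rw [M.rot_three] at this
  exact this.symm

theorem rot_rot_ne (d : D) : M.rot (M.rot d) ≠ d := fun h => by
  have := M.rot_three d
  rw [h] at this
  exact M.rot_ne d this

namespace Config

open scoped Classical in
/-- The spins, extended by `false` to the holes. -/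
noncomputable def spin (c : M.Config) (f : M.Face) : Bool :=
  if h : f ∈ M.hole then false else c ⟨f, h⟩

theorem apply_eq_spin (c : M.Config) (p : M.Plaquette) : c p = c.spin p.1 := by
  rw [spin, dif_neg p.2]; rfl

theorem apply_mk_eq_spin (c : M.Config) {f : M.Face} (h : f ∉ M.hole) :
    c ⟨f, h⟩ = c.spin f :=
  apply_eq_spin c ⟨f, h⟩

theorem spin_flip_self (c : M.Config) (p : M.Plaquette) : (c.flip p).spin p.1 = !c.spin p.1 := by
  classical
  rw [← apply_eq_spin, ← apply_eq_spin, flip, Function.update_self]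

theorem spin_flip_of_ne (c : M.Config) (p : M.Plaquette) {f : M.Face} (h : f ≠ p.1) :
    (c.flip p).spin f = c.spin f := by
  classical
  by_cases hf : f ∈ M.hole
  · simp [spin, hf]
  · have key : ∀ q : M.Plaquette, q ≠ p → (c.flip p).spin q.1 = c.spin q.1 := fun q hq => by
      rw [← apply_eq_spin, ← apply_eq_spin, flip, Function.update_of_ne hq]
    exact key ⟨f, hf⟩ fun h' => h (congrArg Subtype.val h')

theorem flip_flip (c : M.Config) (p : M.Plaquette) : (c.flip p).flip p = c := by
  simp [flip]

theorem flip_comm (c : M.Config) {p q : M.Plaquette} (h : p ≠ q) :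
    (c.flip p).flip q = (c.flip q).flip p := by
  classical
  simp only [flip, Function.update_of_ne h, Function.update_of_ne h.symm]
  exact Function.update_comm h _ _ _

end Config

namespace KasteleynOrientation

variable {o : M.KasteleynOrientation}

theorem typeI_mem_dimers {c : M.Config} {l : o.TypeI} :
    Edge.typeI l ∈ o.dimers c ↔ c.spin (M.left l.1) = c.spin (M.left (M.rev l.1)) := by
  simp only [dimers, Set.mem_ofPred_eq, Config.apply_mk_eq_spin]

/-- Opposing the majority of three Ising spins means standing alone, so a triangle dimer cuts off
the one corner in the minority. -/
theorem typeII_mem_dimers {c : M.Config} {d : D} {h : M.BulkVertex d} :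
    Edge.typeII d h ∈ o.dimers c ↔
      c.spin (M.left d) ≠ c.spin (M.left (M.rot d)) ∧
      c.spin (M.left d) ≠ c.spin (M.left (M.rot (M.rot d))) := by
  simp only [dimers, Set.mem_ofPred_eq, Config.triangleSpin, Config.apply_mk_eq_spin]
  generalize c.spin (M.left d) = x
  generalize c.spin (M.left (M.rot d)) = y
  generalize c.spin (M.left (M.rot (M.rot d))) = z
  revert x y z
  decide

/-- The Majorana `x` is an end of the edge `e`. -/
def Edge.Ends (e : o.Edge) (x : M.Majorana) : Prop := e.fst = x ∨ e.snd = x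

theorem typeI_ends {l : o.TypeI} {x : M.Majorana} :
    (Edge.typeI l).Ends x ↔ x.1 = l.1 ∨ x.1 = M.rev l.1 := by
  exact or_congr (Subtype.ext_iff.trans eq_comm) (Subtype.ext_iff.trans eq_comm)

theorem typeII_ends {d : D} {h : M.BulkVertex d} {x : M.Majorana} :
    (Edge.typeII (o := o) d h).Ends x ↔ x.1 = d ∨ x.1 = M.rot d := by
  exact or_congr (Subtype.ext_iff.trans eq_comm) (Subtype.ext_iff.trans eq_comm)

theorem typeII_congr {d d' : D} {h : M.BulkVertex d} {h' : M.BulkVertex d'} (hd : d = d') :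
    Edge.typeII (o := o) d h = Edge.typeII d' h' := by
  subst hd; rfl

/-- The dimers of a configuration are disjoint. -/
theorem eq_of_ends {c : M.Config} {e f : o.Edge} (he : e ∈ o.dimers c) (hf : f ∈ o.dimers c)
    {x : M.Majorana} (hex : e.Ends x) (hfx : f.Ends x) : e = f := by
  -- A triangle dimer at a Majorana forces opposite spins on the two sides of its dart, a type I
  -- dimer forces equal ones.
  have mixed : ∀ (l : o.TypeI) (d : D) (h : M.BulkVertex d), Edge.typeI l ∈ o.dimers c →
      Edge.typeII d h ∈ o.dimers c → (Edge.typeI l).Ends x →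
      (Edge.typeII (o := o) d h).Ends x → False := by
    intro l d h hl hd hlx hdx
    rw [typeI_mem_dimers] at hl
    rw [typeII_mem_dimers] at hd
    have hx : c.spin (M.left x.1) = c.spin (M.left (M.rev x.1)) := by
      rcases typeI_ends.1 hlx with h | h <;> rw [h]
      · exact hl
      · rw [M.rev_rev]; exact hl.symm
    rw [M.left_rev] at hx
    rcases typeII_ends.1 hdx with h | h <;> rw [h] at hx
    · exact hd.2 hx
    · rw [M.rot_three] at hx; exact hd.1 hx.symm
  cases e with
  | typeI l =>
    cases f with
    | typeI l' =>
      have key : l.1 = l'.1 := by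
        have hl := l.2.2
        have hl' := l'.2.2
        rcases typeI_ends.1 hex with h | h <;> rcases typeI_ends.1 hfx with h' | h'
        · exact h.symm.trans h'
        · rw [h.symm.trans h', o.along_rev, hl'] at hl; simp at hl
        · rw [h'.symm.trans h, o.along_rev, hl] at hl'; simp at hl'
        · exact M.rev.injective (h.symm.trans h')
      exact congrArg _ (Subtype.ext key)
    | typeII d h => exact (mixed l d h he hf hex hfx).elim
  | typeII d h =>
    cases f with
    | typeI l => exact (mixed l d h hf he hfx hex).elim
    | typeII d' h' =>
      apply typeII_congr
      rw [typeII_mem_dimers] at he hf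
      rcases typeII_ends.1 hex with h1 | h1 <;> rcases typeII_ends.1 hfx with h2 | h2
      · exact h1.symm.trans h2
      -- Two corners of a triangle cannot both be in the minority, since three spins take only two
      -- values.
      · have := h1.symm.trans h2
        subst this
        rw [M.rot_three] at he
        have h3 := he.1; have h4 := he.2; have h5 := hf.2
        revert h3 h4 h5
        cases c.spin (M.left d') <;> cases c.spin (M.left (M.rot d')) <;>
          cases c.spin (M.left (M.rot (M.rot d'))) <;> simp
      · have := h2.symm.trans h1
        subst this
        rw [M.rot_three] at hf
        have h3 := he.2; have h4 := hf.1; have h5 := hf.2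
        revert h3 h4 h5
        cases c.spin (M.left d) <;> cases c.spin (M.left (M.rot d)) <;>
          cases c.spin (M.left (M.rot (M.rot d))) <;> simp
      · exact M.rot.injective (h1.symm.trans h2)

end KasteleynOrientation

end OpenCellulation

/-! ### Anticommuting elements of an algebra. -/

/-- Two elements of a complex algebra anticommute. -/
def Anticommute {R : Type*} [Ring R] [Algebra ℂ R] (x y : R) : Prop :=
  x * y = (-1 : ℂ) • (y * x)

namespace Anticommute

variable {R : Type*} [Ring R] [Algebra ℂ R] {x y z : R}

theorem symm (h : Anticommute x y) : Anticommute y x := by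
  unfold Anticommute at *
  rw [h, smul_smul]; norm_num

theorem smul_left (h : Anticommute x y) (r : ℂ) : Anticommute (r • x) y := by
  unfold Anticommute at *
  rw [smul_mul_assoc, mul_smul_comm, h, smul_comm]

theorem smul_right (h : Anticommute x y) (r : ℂ) : Anticommute x (r • y) :=
  (h.symm.smul_left r).symm

theorem add_left (h : Anticommute x z) (h' : Anticommute y z) : Anticommute (x + y) z := by
  unfold Anticommute at *
  rw [add_mul, mul_add, h, h', smul_add]

theorem add_right (h : Anticommute x y) (h' : Anticommute x z) : Anticommute x (y + z) :=
  (h.symm.add_left h'.symm).symm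

theorem sub_left (h : Anticommute x z) (h' : Anticommute y z) : Anticommute (x - y) z := by
  unfold Anticommute at *
  rw [sub_mul, mul_sub, h, h', smul_sub]

theorem sub_right (h : Anticommute x y) (h' : Anticommute x z) : Anticommute x (y - z) :=
  (h.symm.sub_left h'.symm).symm

theorem mul_self_eq_zero (h : Anticommute x x) : x * x = 0 := by
  have h2 : (2 : ℂ) • (x * x) = 0 := by
    rw [two_smul]
    nth_rewrite 1 [h]
    rw [neg_one_smul, neg_add_cancel]
  simpa using h2

theorem commute_mul (h : Anticommute x z) (h' : Anticommute y z) : Commute (x * y) z := by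
  change _ * _ = _ * _
  rw [mul_assoc, h', mul_smul_comm, ← mul_assoc, h, smul_mul_assoc, smul_smul, mul_assoc]
  norm_num

theorem mul_left (h : Anticommute x z) (h' : Commute y z) : Anticommute (x * y) z := by
  unfold Anticommute at *
  rw [mul_assoc, h'.eq, ← mul_assoc, h, smul_mul_assoc, mul_assoc]

theorem mul_left' (h : Commute x z) (h' : Anticommute y z) : Anticommute (x * y) z := by
  unfold Anticommute at *
  rw [mul_assoc, h', mul_smul_comm, ← mul_assoc, h.eq, mul_assoc]

end Anticommute

section CanonicalAnticommutation

theorem add_mul_self_eq_one {R : Type*} [Ring R] {a c : R} (ha : a * a = 0) (hc : c * c = 0) (h : a * c = 1 - c * a) :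
    (a + c) * (a + c) = 1 := by
  rw [add_mul, mul_add, mul_add, ha, hc, h]; abel

variable {R : Type*} [Ring R] [Algebra ℂ R] {a c : R}

theorem I_smul_sub_mul_self_eq_one (ha : a * a = 0) (hc : c * c = 0) (h : a * c = 1 - c * a) :
    (Complex.I • (c - a)) * (Complex.I • (c - a)) = 1 := by
  rw [smul_mul_smul_comm, Complex.I_mul_I, sub_mul, mul_sub, mul_sub, ha, hc, h, neg_one_smul]
  abel

theorem anticommute_add_I_smul_sub (ha : a * a = 0) (hc : c * c = 0) :
    Anticommute (a + c) (Complex.I • (c - a)) := by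
  refine Anticommute.smul_right ?_ _
  unfold Anticommute
  rw [neg_one_smul]
  simp only [add_mul, mul_add, mul_sub, sub_mul, ha, hc]
  abel

end CanonicalAnticommutation

/-! ### Majorana operators, edge parities and their projectors. -/

namespace OpenCellulation

variable {D : Type*} {M : OpenCellulation D}

namespace KasteleynOrientation

variable {o : M.KasteleynOrientation}

theorem anticommute_create (l m : o.TypeI) : Anticommute (o.create l) (o.create m) := by
  classical
  refine LinearMap.ext fun v => ?_
  change ExteriorAlgebra.ι ℂ (Pi.single l 1) * (ExteriorAlgebra.ι ℂ (Pi.single m 1) * v) =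
    (-1 : ℂ) • (ExteriorAlgebra.ι ℂ (Pi.single m 1) * (ExteriorAlgebra.ι ℂ (Pi.single l 1) * v))
  rw [← mul_assoc, ← mul_assoc, neg_one_smul, ← neg_mul,
    eq_neg_of_add_eq_zero_left (ExteriorAlgebra.ι_add_mul_swap _ _)]

theorem anticommute_annihilate (l m : o.TypeI) :
    Anticommute (o.annihilate l) (o.annihilate m) := by
  have key : ∀ v, o.annihilate l (o.annihilate m v) = -o.annihilate m (o.annihilate l v) :=
    fun v => CliffordAlgebra.contractLeft_comm (Q := (0 : QuadraticForm ℂ (o.TypeI → ℂ)))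
      (d := (LinearMap.proj l : (o.TypeI → ℂ) →ₗ[ℂ] ℂ))
      (d' := (LinearMap.proj m : (o.TypeI → ℂ) →ₗ[ℂ] ℂ)) v
  refine LinearMap.ext fun v => (key v).trans ?_
  rw [← neg_one_smul ℂ]; rfl

open scoped Classical in
theorem annihilate_create_apply (l m : o.TypeI) (v : o.Fock) :
    o.annihilate l (o.create m v) =
      (if l = m then v else 0) - o.create m (o.annihilate l v) := by
  have := CliffordAlgebra.contractLeft_ι_mul (Q := (0 : QuadraticForm ℂ (o.TypeI → ℂ)))
    (d := (LinearMap.proj l : (o.TypeI → ℂ) →ₗ[ℂ] ℂ)) (Pi.single m 1) v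
  refine this.trans ?_
  congr 1
  by_cases h : l = m
  · subst h; simp
  · simp [h]

theorem annihilate_mul_create_self (l : o.TypeI) :
    o.annihilate l * o.create l = 1 - o.create l * o.annihilate l := by
  refine LinearMap.ext fun v => (annihilate_create_apply l l v).trans ?_
  rw [if_pos rfl]; rfl

theorem anticommute_annihilate_create {l m : o.TypeI} (h : l ≠ m) :
    Anticommute (o.annihilate l) (o.create m) := by
  refine LinearMap.ext fun v => (annihilate_create_apply l m v).trans ?_
  rw [if_neg h, zero_sub, ← neg_one_smul ℂ]; rfl

theorem γ_of_along {x : M.Majorana} {l : o.TypeI} (h : l.1 = x.1) :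
    o.γ x = o.annihilate l + o.create l := by
  have hx : o.along x.1 = true := h ▸ l.2.2
  have : l = ⟨x.1, x.2, hx⟩ := Subtype.ext h
  rw [this]
  exact dif_pos hx

theorem γ_of_rev_along {x : M.Majorana} {l : o.TypeI} (h : l.1 = M.rev x.1) :
    o.γ x = Complex.I • (o.create l - o.annihilate l) := by
  have hx : o.along (M.rev x.1) = true := h ▸ l.2.2
  have hneg : ¬ o.along x.1 = true := by
    rw [o.along_rev] at hx; simpa using hx
  have : l = ⟨M.rev x.1, x.2.rev, hx⟩ := Subtype.ext h
  rw [this]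
  exact dif_neg hneg

/-- Every Majorana is an end of a type I edge. -/
theorem exists_typeI (o : M.KasteleynOrientation) (x : M.Majorana) :
    ∃ l : o.TypeI, l.1 = x.1 ∨ l.1 = M.rev x.1 := by
  by_cases h : o.along x.1 = true
  · exact ⟨⟨x.1, x.2, h⟩, Or.inl rfl⟩
  · exact ⟨⟨M.rev x.1, x.2.rev, by rw [o.along_rev]; simpa using h⟩, Or.inr rfl⟩

theorem γ_mul_self (x : M.Majorana) : o.γ x * o.γ x = 1 := by
  obtain ⟨l, h | h⟩ := exists_typeI o x
  · rw [γ_of_along h]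
    exact add_mul_self_eq_one (anticommute_annihilate l l).mul_self_eq_zero
      (anticommute_create l l).mul_self_eq_zero (annihilate_mul_create_self l)
  · rw [γ_of_rev_along h]
    exact I_smul_sub_mul_self_eq_one (anticommute_annihilate l l).mul_self_eq_zero
      (anticommute_create l l).mul_self_eq_zero (annihilate_mul_create_self l)

theorem anticommute_γ {x y : M.Majorana} (hxy : x ≠ y) : Anticommute (o.γ x) (o.γ y) := by
  have hxy' : x.1 ≠ y.1 := fun h => hxy (Subtype.ext h)
  obtain ⟨l, hl⟩ := exists_typeI o x
  obtain ⟨m, hm⟩ := exists_typeI o y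
  -- The two Majoranas of one mode anticommute because the squares of its creation and annihilation
  -- operators vanish; for different modes all four pairs of operators anticommute.
  by_cases hlm : l = m
  · subst hlm
    have ha := (anticommute_annihilate l l).mul_self_eq_zero
    have hc := (anticommute_create l l).mul_self_eq_zero
    rcases hl with hl | hl <;> rcases hm with hm | hm
    · exact (hxy' (hl.symm.trans hm)).elim
    · rw [γ_of_along hl, γ_of_rev_along hm]
      exact anticommute_add_I_smul_sub ha hc
    · rw [γ_of_along hm, γ_of_rev_along hl]
      exact (anticommute_add_I_smul_sub ha hc).symm
    · exact (hxy' (M.rev.injective (hl.symm.trans hm))).elim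
  · have h1 := anticommute_annihilate l m
    have h2 := anticommute_create l m
    have h3 := anticommute_annihilate_create hlm
    have h4 := (anticommute_annihilate_create (Ne.symm hlm)).symm
    rcases hl with hl | hl <;> rcases hm with hm | hm
    · rw [γ_of_along hl, γ_of_along hm]
      exact (h1.add_right h3).add_left (h4.add_right h2)
    · rw [γ_of_along hl, γ_of_rev_along hm]
      exact ((h3.sub_right h1).add_left (h2.sub_right h4)).smul_right _
    · rw [γ_of_rev_along hl, γ_of_along hm]
      exact ((h4.add_right h2).sub_left (h1.add_right h3)).smul_left _
    · rw [γ_of_rev_along hl, γ_of_rev_along hm]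
      exact (((h2.sub_right h4).sub_left (h3.sub_right h1)).smul_right _).smul_left _

theorem Edge.fst_ne_snd (e : o.Edge) : e.fst ≠ e.snd := by
  intro h
  cases e with
  | typeI l => exact M.rev_ne l.1 (congrArg Subtype.val h).symm
  | typeII d hd => exact M.rot_ne d (congrArg Subtype.val h).symm

theorem Edge.sign_mul_self (e : o.Edge) : e.sign * e.sign = 1 := by
  cases e with
  | typeI l => simp [Edge.sign]
  | typeII d hd => cases h : o.turn d <;> simp [Edge.sign, h]

theorem parity_mul_self (e : o.Edge) : o.parity e * o.parity e = 1 := by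
  have h1 : o.γ e.fst * o.γ e.snd * (o.γ e.fst * o.γ e.snd) = (-1 : ℂ) • 1 := by
    rw [mul_assoc, ← mul_assoc (o.γ e.snd), anticommute_γ e.fst_ne_snd.symm, smul_mul_assoc,
      mul_smul_comm, mul_assoc, γ_mul_self, mul_one, γ_mul_self]
  rw [parity, smul_mul_smul_comm, h1, smul_smul, show Complex.I * e.sign * (Complex.I * e.sign) =
    (Complex.I * Complex.I) * (e.sign * e.sign) by ring, e.sign_mul_self, Complex.I_mul_I]
  simp

/-- A parity commutes with the Majoranas that are not on its edge. -/
theorem commute_parity_γ {e : o.Edge} {x : M.Majorana} (h : ¬ e.Ends x) :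
    Commute (o.parity e) (o.γ x) :=
  ((anticommute_γ fun h' => h (Or.inl h')).commute_mul
    (anticommute_γ fun h' => h (Or.inr h'))).smul_left _

/-- A parity anticommutes with the Majoranas on its edge. -/
theorem anticommute_parity_γ {e : o.Edge} {x : M.Majorana} (h : e.Ends x) :
    Anticommute (o.parity e) (o.γ x) := by
  refine Anticommute.smul_left ?_ _
  rcases h with rfl | rfl
  · exact Anticommute.mul_left' (Commute.refl _) (anticommute_γ e.fst_ne_snd.symm)
  · exact (anticommute_γ e.fst_ne_snd).mul_left (Commute.refl _)

theorem commute_parity {A : Module.End ℂ o.Fock} {e : o.Edge}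
    (h : ∀ x, e.Ends x → Commute A (o.γ x)) : Commute A (o.parity e) :=
  ((h _ (Or.inl rfl)).mul_right (h _ (Or.inr rfl))).smul_right _

theorem commute_proj {A : Module.End ℂ o.Fock} {e : o.Edge} (h : Commute A (o.parity e)) :
    Commute A (o.proj e) :=
  ((Commute.one_right _).add_right h).smul_right _

theorem parity_commute_parity {c : M.Config} {e f : o.Edge} (he : e ∈ o.dimers c)
    (hf : f ∈ o.dimers c) : Commute (o.parity e) (o.parity f) := by
  by_cases hef : e = f
  · rw [hef]
  · exact commute_parity fun x hx => commute_parity_γ fun hx' => hef (eq_of_ends he hf hx' hx)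

theorem proj_commute_proj {c : M.Config} {e f : o.Edge} (he : e ∈ o.dimers c)
    (hf : f ∈ o.dimers c) : Commute (o.proj e) (o.proj f) :=
  commute_proj (commute_proj (parity_commute_parity hf he)).symm

theorem proj_mul_parity (e : o.Edge) : o.proj e * o.parity e = o.proj e := by
  rw [proj, smul_mul_assoc, add_mul, parity_mul_self, one_mul, add_comm]

theorem proj_apply_of_parity {e : o.Edge} {v : o.Fock} (h : o.parity e v = v) :
    o.proj e v = v := by
  rw [proj, LinearMap.smul_apply, LinearMap.add_apply, h, Module.End.one_apply, ← two_smul ℂ,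
    smul_smul]
  norm_num

/-- The orientation of a triangle multiplies to `-1`. -/
theorem sign_triangle {d : D} (h : M.BulkVertex d) :
    (Edge.typeII (o := o) d h).sign * (Edge.typeII (o := o) _ h.rot).sign *
      (Edge.typeII (o := o) _ h.rot.rot).sign = -1 := by
  classical
  have key := o.triangle_odd d h
  have hset : {e | e ∈ ({d, M.rot d, M.rot (M.rot d)} : Set D) ∧ o.turn e = false} =
      ((({d, M.rot d, M.rot (M.rot d)} : Finset D).filter (o.turn · = false) : Finset D) :
        Set D) := by
    ext e; simp
  have h1 : d ≠ M.rot d := (M.rot_ne d).symm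
  have h2 : d ≠ M.rot (M.rot d) := (rot_rot_ne d).symm
  have h3 : M.rot d ≠ M.rot (M.rot d) := (M.rot_ne _).symm
  rw [hset, Set.ncard_coe_finset, Finset.card_filter, Finset.sum_insert (by simp [h1, h2]),
    Finset.sum_insert (by simp [h3]), Finset.sum_singleton] at key
  simp only [Edge.sign]
  revert key
  cases o.turn d <;> cases o.turn (M.rot d) <;> cases o.turn (M.rot (M.rot d)) <;>
    simp

/-- The Kasteleyn relation of the three parities at a triangle. -/
theorem parity_triangle {d : D} (h : M.BulkVertex d) :
    o.parity (.typeII d h) * o.parity (.typeII _ h.rot) * o.parity (.typeII _ h.rot.rot) =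
      Complex.I • 1 := by
  have hs := sign_triangle (o := o) h
  have e1 : (Edge.typeII (o := o) d h).snd = (Edge.typeII (o := o) _ h.rot).fst := rfl
  have e2 : (Edge.typeII (o := o) _ h.rot).snd = (Edge.typeII (o := o) _ h.rot.rot).fst := rfl
  have e3 : (Edge.typeII (o := o) _ h.rot.rot).snd = (Edge.typeII (o := o) d h).fst :=
    Subtype.ext (M.rot_three d)
  rw [parity, parity, parity, smul_mul_smul_comm, smul_mul_smul_comm, ← e1, ← e2, e3]
  have : ∀ a b c : Module.End ℂ o.Fock, a * a = 1 → b * b = 1 → c * c = 1 →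
      a * b * (b * c) * (c * a) = 1 := by
    intro a b c ha hb hc
    rw [mul_assoc a, ← mul_assoc b, hb, one_mul, mul_assoc a, ← mul_assoc c, hc, one_mul, ha]
  rw [this _ _ _ (γ_mul_self _) (γ_mul_self _) (γ_mul_self _)]
  congr 1
  -- Three factors i give -i, and the product -1 of the orientation signs turns this into i.
  linear_combination (Complex.I ^ 3) * hs - Complex.I * Complex.I_sq

end KasteleynOrientation

end OpenCellulation

/-! ### Shared edges, and the projectors that survive two flips. -/

namespace OpenCellulation

variable {D : Type*} {M : OpenCellulation D}

open scoped Classical in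
theorem Config.spin_flip (c : M.Config) (p : M.Plaquette) (f : M.Face) :
    (c.flip p).spin f = if f = p.1 then !c.spin f else c.spin f := by
  split_ifs with h
  · rw [h]; exact c.spin_flip_self p
  · exact c.spin_flip_of_ne p h

variable (M) in
/-- The dart `x` has the same tail as `d`. -/
def AtVertex (d x : D) : Prop := x = d ∨ x = M.rot d ∨ x = M.rot (M.rot d)

variable (M) in
/-- The tail of the dart `x` is an end of the edge of `d`. -/
def AtEdge (d x : D) : Prop := M.AtVertex d x ∨ M.AtVertex (M.rev d) x

/-- The edge of `d` separates the plaquettes `p` and `q`. -/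
def Between (p q : M.Plaquette) (d : D) : Prop :=
  (M.left d = p.1 ∧ M.left (M.rev d) = q.1) ∨ (M.left d = q.1 ∧ M.left (M.rev d) = p.1)

namespace Between

variable {p q : M.Plaquette} {d d' x : D}

theorem rev (h : Between p q d) : Between p q (M.rev d) := by
  unfold Between at *
  rw [M.rev_rev]
  tauto

theorem symm (h : Between p q d) : Between q p d := Or.symm h

theorem ne (h : Between p q d) : p ≠ q := by
  rintro rfl
  rcases h with h | h <;> exact M.left_rev_ne d (h.2.trans h.1.symm)

theorem inner (h : Between p q d) : M.Inner d := by
  rcases h with h | h <;> refine ⟨?_, ?_⟩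
  · rw [h.1]; exact p.2
  · rw [h.2]; exact q.2
  · rw [h.1]; exact q.2
  · rw [h.2]; exact p.2

/-- The three faces at a vertex are pairwise different, so only one of its edges can separate p from
q. This makes distinct shared edges disjoint, and the operators at their ends commute. -/
theorem not_rot (h : Between p q d) : ¬ Between p q (M.rot d) := by
  intro h'
  have h1 := left_rot_rot_ne (M := M) d
  have h2 := left_rot_ne (M := M) d
  have h3 := left_rot_ne (M := M) (M.rot d)
  unfold Between at h h'
  rw [M.left_rev] at h h'
  rw [M.rot_three] at h'
  grind

theorem eq_of_atVertex (h : Between p q d) (h' : Between p q d') (hx : M.AtVertex d x)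
    (hx' : M.AtVertex d' x) : d = d' := by
  have key : d = d' ∨ d = M.rot d' ∨ d' = M.rot d := by
    have h1 := M.rot_three d
    have h2 := M.rot_three d'
    have h3 := M.rot.injective.eq_iff (a := d) (b := d')
    have h4 := M.rot.injective.eq_iff (a := M.rot d) (b := M.rot d')
    have h5 := M.rot.injective.eq_iff (a := M.rot d) (b := d')
    have h6 := M.rot.injective.eq_iff (a := d) (b := M.rot d')
    unfold AtVertex at hx hx'
    grind
  rcases key with key | rfl | rfl
  · exact key
  · exact (h'.not_rot h).elim
  · exact (h.not_rot h').elim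

theorem eq_or_eq_rev (h : Between p q d) (h' : Between p q d') (hx : M.AtEdge d x)
    (hx' : M.AtEdge d' x) : d = d' ∨ d = M.rev d' := by
  rcases hx with hx | hx <;> rcases hx' with hx' | hx'
  · exact Or.inl (h.eq_of_atVertex h' hx hx')
  · exact Or.inr (h.eq_of_atVertex h'.rev hx hx')
  · exact Or.inr (by rw [← h.rev.eq_of_atVertex h' hx hx', M.rev_rev])
  · exact Or.inl (M.rev.injective (h.rev.eq_of_atVertex h'.rev hx hx'))

theorem not_atVertex_rev (h : Between p q d) : ¬ M.AtVertex d (M.rev d) := fun hx =>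
  M.rev_ne d (h.eq_of_atVertex h.rev hx (Or.inl rfl)).symm

theorem spin_eq {c : M.Config} (h : Between p q d) (hc : c.spin p.1 = c.spin q.1) :
    c.spin (M.left d) = c.spin (M.left (M.rev d)) := by
  rcases h with h | h <;> rw [h.1, h.2, hc]

theorem spin_flip_ne {c : M.Config} (h : Between p q d) (hc : c.spin p.1 = c.spin q.1) :
    (c.flip p).spin (M.left d) ≠ (c.flip p).spin (M.left (M.rev d)) := by
  have hne : q.1 ≠ p.1 := fun h' => h.ne (Subtype.ext h'.symm)
  rcases h with h | h <;>
    rw [h.1, h.2, Config.spin_flip_self, Config.spin_flip_of_ne _ _ hne, hc] <;> simp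

end Between

theorem spin_flip_flip_eq {c : M.Config} {p q : M.Plaquette} (h : p ≠ q)
    (hc : c.spin p.1 = c.spin q.1) :
    ((c.flip p).flip q).spin p.1 = ((c.flip p).flip q).spin q.1 := by
  rw [Config.spin_flip_self, Config.spin_flip_of_ne _ q (fun h' => h (Subtype.ext h')),
    Config.spin_flip_self, Config.spin_flip_of_ne _ p (fun h' => h (Subtype.ext h'.symm)), hc]

namespace KasteleynOrientation

variable {o : M.KasteleynOrientation}

section Products

variable {c : M.Config} {l l' : List o.Edge}

theorem prod_proj_perm (h : l.Perm l') (hl : ∀ e ∈ l, e ∈ o.dimers c) :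
    (l.map o.proj).prod = (l'.map o.proj).prod := by
  refine (h.map _).prod_eq' ?_
  rw [List.pairwise_map]
  exact List.pairwise_of_forall_mem_list fun e he f hf => proj_commute_proj (hl e he) (hl f hf)

theorem commute_prod_proj {A : Module.End ℂ o.Fock} (h : ∀ e ∈ l, Commute A (o.proj e)) :
    Commute A (l.map o.proj).prod :=
  Commute.list_prod_right _ _ fun B hB => by
    obtain ⟨e, he, rfl⟩ := List.mem_map.1 hB
    exact h e he

theorem prod_proj_mul_parity (hl : ∀ e ∈ l, e ∈ o.dimers c) {e : o.Edge} (he : e ∈ l) :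
    (l.map o.proj).prod * o.parity e = (l.map o.proj).prod := by
  induction l with
  | nil => simp at he
  | cons a l ih =>
    rw [List.map_cons, List.prod_cons, mul_assoc]
    rcases List.mem_cons.1 he with rfl | he'
    · have : Commute (o.parity e) (l.map o.proj).prod := commute_prod_proj fun f hf =>
        commute_proj (parity_commute_parity (hl e he) (hl f (List.mem_cons_of_mem _ hf)))
      rw [← this.eq, ← mul_assoc, proj_mul_parity]
    · rw [ih (fun f hf => hl f (List.mem_cons_of_mem _ hf)) he']

theorem prod_proj_apply {v : o.Fock} (h : ∀ e ∈ l, o.parity e v = v) :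
    (l.map o.proj).prod v = v := by
  induction l with
  | nil => rfl
  | cons a l ih =>
    rw [List.map_cons, List.prod_cons, Module.End.mul_apply,
      ih fun e he => h e (List.mem_cons_of_mem _ he),
      proj_apply_of_parity (h a List.mem_cons_self)]

/-- Absorption from the left; with L the projector onto the final dimers, it removes the factors
that the second flip keeps. -/
theorem mul_prod_proj {L : Module.End ℂ o.Fock} (h : ∀ e ∈ l, L * o.parity e = L) :
    L * (l.map o.proj).prod = L := by
  induction l with
  | nil => simp
  | cons a l ih =>
    have ha : L * o.proj a = L := by
      rw [proj, mul_smul_comm, mul_add, h a List.mem_cons_self, mul_one, ← two_smul ℂ, smul_smul]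
      norm_num
    rw [List.map_cons, List.prod_cons, ← mul_assoc, ha,
      ih fun e he => h e (List.mem_cons_of_mem _ he)]

end Products

section Finite

variable [Fintype D]

/-- The product of all projectors onto the dimers of a configuration. -/
noncomputable def dimerProj (o : M.KasteleynOrientation) (c : M.Config) : Module.End ℂ o.Fock :=
  ((Set.toFinite (o.dimers c)).toFinset.toList.map o.proj).prod

theorem dimerProj_mul_parity {c : M.Config} {e : o.Edge} (he : e ∈ o.dimers c) :
    o.dimerProj c * o.parity e = o.dimerProj c :=
  prod_proj_mul_parity (c := c) (by simp) (by simpa using he)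

/-- After the flip the state conforms to the new dimer cover. -/
theorem parity_flipProj {c : M.Config} {p : M.Plaquette} {v : o.Fock}
    (hv : ∀ e ∈ o.dimers c, o.parity e v = v) {e : o.Edge} (he : e ∈ o.dimers (c.flip p)) :
    o.parity e (o.flipProj p c v) = o.flipProj p c v := by
  have hmem : ∀ f ∈ (Set.toFinite (o.dimers (c.flip p) \ o.dimers c)).toFinset.toList,
      f ∈ o.dimers (c.flip p) := by
    intro f hf
    simp only [Finset.mem_toList, Set.Finite.mem_toFinset] at hf
    exact hf.1
  have hcomm : Commute (o.parity e) (o.flipProj p c) :=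
    commute_prod_proj fun f hf => commute_proj (parity_commute_parity he (hmem f hf))
  rw [← Module.End.mul_apply, hcomm.eq]
  by_cases hec : e ∈ o.dimers c
  · rw [Module.End.mul_apply, hv e hec]
  · rw [flipProj, prod_proj_mul_parity hmem (by simpa using ⟨he, hec⟩)]

/-- The projectors onto the dimers common to both covers act trivially on v, so they may be added.
Applied to the second flip, this gives an operator that depends only on the final configuration and
not on the order. -/
theorem flipProj_apply_eq_dimerProj {c : M.Config} {p : M.Plaquette} {v : o.Fock}
    (hv : ∀ e ∈ o.dimers c, o.parity e v = v) :
    o.flipProj p c v = o.dimerProj (c.flip p) v := by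
  classical
  have hperm : (Set.toFinite (o.dimers (c.flip p))).toFinset.toList.Perm
      ((Set.toFinite (o.dimers (c.flip p) \ o.dimers c)).toFinset.toList ++
        (Set.toFinite (o.dimers (c.flip p) ∩ o.dimers c)).toFinset.toList) := by
    refine (List.perm_ext_iff_of_nodup (Finset.nodup_toList _) ?_).2 ?_
    · refine List.nodup_append'.2 ⟨Finset.nodup_toList _, Finset.nodup_toList _, ?_⟩
      intro e he he'
      simp only [Finset.mem_toList, Set.Finite.mem_toFinset] at he he'
      exact he.2 he'.2
    · intro e
      simp only [List.mem_append, Finset.mem_toList, Set.Finite.mem_toFinset, Set.mem_sdiff,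
        Set.mem_inter_iff]
      tauto
  rw [dimerProj, prod_proj_perm (c := c.flip p) hperm (by simp), List.map_append, List.prod_append,
    Module.End.mul_apply, prod_proj_apply
      (l := (Set.toFinite (o.dimers (c.flip p) ∩ o.dimers c)).toFinset.toList), flipProj]
  intro e he
  simp only [Finset.mem_toList, Set.Finite.mem_toFinset] at he
  exact hv e he.2

end Finite

open scoped Classical in
/-- Where the faces on the two sides of `d` have opposite spins, the dimer at the tail of `d`. -/
noncomputable def minorEdge (o : M.KasteleynOrientation) (c : M.Config) (d : D)
    (h : M.BulkVertex d) : o.Edge :=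
  if c.spin (M.left d) = c.spin (M.left (M.rot d)) then .typeII _ h.rot.rot else .typeII d h

theorem minorEdge_eq_or (c : M.Config) {d : D} (h : M.BulkVertex d) :
    o.minorEdge c d h = .typeII _ h.rot.rot ∨ o.minorEdge c d h = .typeII d h := by
  unfold minorEdge; split_ifs <;> simp

theorem minorEdge_atVertex {c : M.Config} {d : D} {h : M.BulkVertex d} {x : M.Majorana}
    (hx : (o.minorEdge c d h).Ends x) : M.AtVertex d x.1 := by
  unfold AtVertex
  rcases minorEdge_eq_or (o := o) c h with h' | h' <;> rw [h', typeII_ends] at hx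
  · rw [M.rot_three] at hx; tauto
  · tauto

theorem minorEdge_ends_self (c : M.Config) {d : D} (h : M.BulkVertex d) :
    (o.minorEdge c d h).Ends ⟨d, h.inner⟩ := by
  rcases minorEdge_eq_or (o := o) c h with h' | h' <;> rw [h']
  · exact typeII_ends.2 (Or.inr (M.rot_three d).symm)
  · exact typeII_ends.2 (Or.inl rfl)

theorem minorEdge_mem {c : M.Config} {d : D} (h : M.BulkVertex d)
    (hc : c.spin (M.left d) ≠ c.spin (M.left (M.rev d))) : o.minorEdge c d h ∈ o.dimers c := by
  rw [M.left_rev] at hc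
  unfold minorEdge
  split_ifs with h' <;> rw [typeII_mem_dimers]
  · rw [M.rot_three, ← h']; exact ⟨hc.symm, hc.symm⟩
  · exact ⟨h', hc⟩

/-- Both triangle edges at the Majorana of `d` need opposite spins on the sides of `d`, so it does
not matter which of them `c'` selects. -/
theorem minorEdge_notMem {c c' : M.Config} {d : D} (h : M.BulkVertex d)
    (hc : c.spin (M.left d) = c.spin (M.left (M.rev d))) : o.minorEdge c' d h ∉ o.dimers c := by
  rw [M.left_rev] at hc
  rcases minorEdge_eq_or (o := o) c' h with h' | h' <;> rw [h', typeII_mem_dimers]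
  · rw [M.rot_three]; exact fun h => h.1 hc.symm
  · exact fun h => h.2 hc

theorem minorEdge_of_mem {c : M.Config} {d : D} {h : M.BulkVertex d}
    (hd : Edge.typeII d h ∈ o.dimers c) :
    o.minorEdge c d h = .typeII d h ∧ o.minorEdge c _ h.rot = .typeII d h := by
  rw [typeII_mem_dimers] at hd
  refine ⟨if_neg hd.1, ?_⟩
  unfold minorEdge
  rw [if_pos]
  · exact typeII_congr (M.rot_three d)
  · have h1 := hd.1; have h2 := hd.2
    revert h1 h2
    cases c.spin (M.left d) <;> cases c.spin (M.left (M.rot d)) <;>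
      cases c.spin (M.left (M.rot (M.rot d))) <;> simp

/-- A flip of `p` can change a triangle edge only at a corner of `p`. -/
theorem typeII_mem_flip {c : M.Config} {p : M.Plaquette} {d : D} {h : M.BulkVertex d}
    (h0 : M.left d ≠ p.1) (h1 : M.left (M.rot d) ≠ p.1) (h2 : M.left (M.rot (M.rot d)) ≠ p.1) :
    Edge.typeII d h ∈ o.dimers (c.flip p) ↔ Edge.typeII d h ∈ o.dimers c := by
  rw [typeII_mem_dimers, typeII_mem_dimers, Config.spin_flip_of_ne _ _ h0,
    Config.spin_flip_of_ne _ _ h1, Config.spin_flip_of_ne _ _ h2]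

/-- The new dimers that are removed by the second flip sit at the ends of the edges shared by the
two plaquettes. -/
theorem exists_minorEdge {c : M.Config} {p q : M.Plaquette} (hpq : p ≠ q)
    (hc : c.spin p.1 = c.spin q.1) {e : o.Edge} (he : e ∈ o.dimers (c.flip p))
    (he' : e ∉ o.dimers c) (he'' : e ∉ o.dimers ((c.flip p).flip q)) :
    ∃ (d : D) (h : M.BulkVertex d), Between p q d ∧ e = o.minorEdge (c.flip p) d h := by
  have hqp' : q.1 ≠ p.1 := fun h => hpq (Subtype.ext h.symm)
  have sp := c.spin_flip_self p
  have sq := c.spin_flip_of_ne p hqp'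
  cases e with
  | typeI l =>
    -- A type I dimer created by one flip and removed by the other would separate p from q, but the
    -- spins there differ after the first flip.
    exfalso
    rw [typeI_mem_dimers] at he he' he''
    have hl := M.left_rev_ne l.1
    rw [Config.spin_flip, Config.spin_flip] at he''
    grind [Config.spin_flip]
  | typeII d h =>
    have hm := minorEdge_of_mem he
    have hp : M.left d = p.1 ∨ M.left (M.rot d) = p.1 ∨ M.left (M.rot (M.rot d)) = p.1 := by
      by_contra hcon
      push Not at hcon
      exact he' ((typeII_mem_flip hcon.1 hcon.2.1 hcon.2.2).1 he)
    have hq : M.left d = q.1 ∨ M.left (M.rot d) = q.1 ∨ M.left (M.rot (M.rot d)) = q.1 := by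
      by_contra hcon
      push Not at hcon
      exact he'' ((typeII_mem_flip hcon.1 hcon.2.1 hcon.2.2).2 he)
    rw [typeII_mem_dimers] at he
    -- After the first flip p and q are opposite, so the minority corner is one of them, and a side
    -- of that corner separates them.
    have key : Between p q d ∨ Between p q (M.rot d) := by
      unfold Between
      rw [M.left_rev, M.left_rev, M.rot_three]
      grind
    rcases key with key | key
    · exact ⟨d, h, key, hm.1.symm⟩
    · exact ⟨_, h.rot, key, hm.2.symm⟩

/-- A list of darts that contains every edge shared by `p` and `q` in exactly one direction. -/
structure SharedDarts (p q : M.Plaquette) (ds : List D) : Prop where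
  nodup : ds.Nodup
  between : ∀ d ∈ ds, Between p q d
  complete : ∀ d, Between p q d → d ∈ ds ∨ M.rev d ∈ ds
  rev_notMem : ∀ d ∈ ds, M.rev d ∉ ds

theorem SharedDarts.symm {p q : M.Plaquette} {ds : List D} (h : SharedDarts p q ds) :
    SharedDarts q p ds :=
  ⟨h.nodup, fun d hd => (h.between d hd).symm, fun d hd => h.complete d hd.symm, h.rev_notMem⟩

theorem SharedDarts.eq_of_atEdge {p q : M.Plaquette} {ds : List D} (h : SharedDarts p q ds)
    {d d' x : D} (hd : d ∈ ds) (hd' : d' ∈ ds) (hx : M.AtEdge d x) (hx' : M.AtEdge d' x) :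
    d = d' := by
  rcases (h.between d hd).eq_or_eq_rev (h.between d' hd') hx hx' with h' | h'
  · exact h'
  · exact (h.rev_notMem d' hd' (h' ▸ hd)).elim

open scoped Classical in
/-- The dimers at the ends of the edge of `d`. -/
noncomputable def endEdges (o : M.KasteleynOrientation) (c : M.Config) (d : D) : List o.Edge :=
  (if h : M.BulkVertex d then [o.minorEdge c d h] else []) ++
    (if h : M.BulkVertex (M.rev d) then [o.minorEdge c _ h] else [])

theorem mem_endEdges {c : M.Config} {d : D} {e : o.Edge} :
    e ∈ o.endEdges c d ↔ (∃ h : M.BulkVertex d, e = o.minorEdge c d h) ∨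
      ∃ h : M.BulkVertex (M.rev d), e = o.minorEdge c _ h := by
  unfold endEdges
  rw [List.mem_append]
  refine or_congr ?_ ?_ <;> split_ifs with h <;> simp [h]

theorem endEdges_atEdge {c : M.Config} {d : D} {e : o.Edge} (he : e ∈ o.endEdges c d)
    {x : M.Majorana} (hx : e.Ends x) : M.AtEdge d x.1 := by
  rcases mem_endEdges.1 he with ⟨h, rfl⟩ | ⟨h, rfl⟩
  · exact Or.inl (minorEdge_atVertex hx)
  · exact Or.inr (minorEdge_atVertex hx)

theorem nodup_endEdges {c : M.Config} {p q : M.Plaquette} {d : D} (hd : Between p q d) :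
    (o.endEdges c d).Nodup := by
  unfold endEdges
  split_ifs with h1 h2 <;> try simp
  intro heq
  have e1 := minorEdge_ends_self (o := o) c h1
  rw [heq] at e1
  exact M.rev_ne d (hd.eq_of_atVertex hd.rev (Or.inl rfl) (minorEdge_atVertex e1)).symm

/-- The flip projector, up to factors that are absorbed by the projector onto the dimers after a
second flip. -/
theorem mul_flipProj [Fintype D] {c : M.Config} {p q : M.Plaquette} {ds : List D} (hpq : p ≠ q)
    (hds : SharedDarts p q ds) (hc : c.spin p.1 = c.spin q.1) {L : Module.End ℂ o.Fock}
    (hL : ∀ e ∈ o.dimers ((c.flip p).flip q), L * o.parity e = L) :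
    L * o.flipProj p c =
      L * (ds.map fun d => ((o.endEdges (c.flip p) d).map o.proj).prod).prod := by
  classical
  have hmemE : ∀ d ∈ ds, ∀ e ∈ o.endEdges (c.flip p) d, e ∈ o.dimers (c.flip p) ∧
      e ∉ o.dimers c ∧ e ∉ o.dimers ((c.flip p).flip q) := by
    have aux : ∀ d (h : M.BulkVertex d), Between p q d →
        o.minorEdge (c.flip p) d h ∈ o.dimers (c.flip p) ∧
        o.minorEdge (c.flip p) d h ∉ o.dimers c ∧
        o.minorEdge (c.flip p) d h ∉ o.dimers ((c.flip p).flip q) := fun d h hd =>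
      ⟨minorEdge_mem h (hd.spin_flip_ne hc), minorEdge_notMem h (hd.spin_eq hc),
        minorEdge_notMem h (hd.spin_eq (spin_flip_flip_eq hpq hc))⟩
    intro d hd e he
    rcases mem_endEdges.1 he with ⟨h, rfl⟩ | ⟨h, rfl⟩
    · exact aux d h (hds.between d hd)
    · exact aux _ h (hds.between d hd).rev
  -- The new dimers are sorted by whether they outlast the second flip; those that do are absorbed
  -- by L.
  have hperm : (Set.toFinite (o.dimers (c.flip p) \ o.dimers c)).toFinset.toList.Perm
      ((Set.toFinite ((o.dimers (c.flip p) \ o.dimers c) ∩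
        o.dimers ((c.flip p).flip q))).toFinset.toList ++ ds.flatMap (o.endEdges (c.flip p))) := by
    refine (List.perm_ext_iff_of_nodup (Finset.nodup_toList _) ?_).2 ?_
    · refine List.nodup_append'.2 ⟨Finset.nodup_toList _, ?_, ?_⟩
      · refine List.nodup_flatMap.2 ⟨fun d hd => nodup_endEdges (hds.between d hd), ?_⟩
        refine hds.nodup.pairwise_of_forall_ne fun d hd d' hd' hne e he he' => hne ?_
        exact hds.eq_of_atEdge hd hd' (endEdges_atEdge he (Or.inl rfl))
          (endEdges_atEdge he' (Or.inl rfl))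
      · intro e he he'
        simp only [Finset.mem_toList, Set.Finite.mem_toFinset] at he
        obtain ⟨d, hd, hed⟩ := List.mem_flatMap.1 he'
        exact (hmemE d hd e hed).2.2 he.2
    · intro e
      simp only [List.mem_append, Finset.mem_toList, Set.Finite.mem_toFinset, List.mem_flatMap]
      constructor
      · intro he
        by_cases heE : e ∈ o.dimers ((c.flip p).flip q)
        · exact Or.inl ⟨he, heE⟩
        · obtain ⟨d, h, hd, rfl⟩ := exists_minorEdge hpq hc he.1 he.2 heE
          right
          rcases hds.complete d hd with h' | h'
          · exact ⟨d, h', mem_endEdges.2 (Or.inl ⟨h, rfl⟩)⟩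
          · have hr : M.BulkVertex (M.rev (M.rev d)) := by rw [M.rev_rev]; exact h
            refine ⟨_, h', mem_endEdges.2 (Or.inr ⟨hr, ?_⟩)⟩
            congr 1
            exact (M.rev_rev d).symm
      · rintro (he | ⟨d, hd, he⟩)
        · exact he.1
        · exact ⟨(hmemE d hd e he).1, (hmemE d hd e he).2.1⟩
  have hflat : ∀ ds : List D, ((ds.flatMap (o.endEdges (c.flip p))).map o.proj).prod =
      (ds.map fun d => ((o.endEdges (c.flip p) d).map o.proj).prod).prod := by
    intro ds
    induction ds with
    | nil => rfl
    | cons d ds ih => simp only [List.flatMap_cons, List.map_append, List.prod_append, List.map_cons,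
        List.prod_cons, ih]
  rw [flipProj, prod_proj_perm (c := c.flip p) hperm, List.map_append, List.prod_append,
    ← mul_assoc, hflat, mul_prod_proj (L := L)]
  · intro e he
    simp only [Finset.mem_toList, Set.Finite.mem_toFinset] at he
    exact hL e he.2
  · intro e he
    simp only [Finset.mem_toList, Set.Finite.mem_toFinset] at he
    exact he.1

end KasteleynOrientation

end OpenCellulation

/-! ### Independence of the order of two flips, up to normalization. -/

namespace OpenCellulation

variable {D : Type*} {M : OpenCellulation D}

namespace KasteleynOrientation

variable {o : M.KasteleynOrientation}

/-- The edge inherited from the edge of an inner dart. -/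
theorem exists_typeI_ends (o : M.KasteleynOrientation) {d : D} (h : M.Inner d) :
    ∃ l : o.TypeI, (l.1 = d ∨ l.1 = M.rev d) ∧ (∀ x : M.Majorana,
      (Edge.typeI l).Ends x ↔ x.1 = d ∨ x.1 = M.rev d) := by
  obtain ⟨l, hl⟩ := exists_typeI o ⟨d, h⟩
  refine ⟨l, hl, fun x => ?_⟩
  rw [typeI_ends]
  rcases hl with hl | hl <;> rw [hl]
  rw [M.rev_rev]
  exact or_comm

theorem anticommute_parity_parity {e f : o.Edge} {x y : M.Majorana} (hf : ∀ z, f.Ends z ↔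
    z = x ∨ z = y) (hex : e.Ends x) (hey : ¬ e.Ends y) :
    Anticommute (o.parity e) (o.parity f) := by
  refine Anticommute.smul_right ?_ _
  have h1 := (hf f.fst).1 (Or.inl rfl)
  have h2 := (hf f.snd).1 (Or.inr rfl)
  have h3 := f.fst_ne_snd
  rcases h1 with h1 | h1 <;> rcases h2 with h2 | h2
  · exact (h3 (h1.trans h2.symm)).elim
  · rw [h1, h2]
    exact ((anticommute_parity_γ hex).symm.mul_left (commute_parity_γ hey).symm).symm
  · rw [h1, h2]
    exact (Anticommute.mul_left' (commute_parity_γ hey).symm (anticommute_parity_γ hex).symm).symm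
  · exact (h3 (h1.trans h2.symm)).elim

/-- An operator that anticommutes with a conserved parity has no matrix elements. -/
theorem apply_eq_zero_of_anticommute {L Z Q T : Module.End ℂ o.Fock} {v : o.Fock}
    (hL : L * T = L) (hZ : Commute Z T) (hQ : Anticommute Q T) (hv : T v = v) :
    L (Z (Q v)) = 0 := by
  have h1 : L * Z * Q * T = (-1 : ℂ) • (L * Z * Q) := by
    rw [mul_assoc, hQ, mul_smul_comm, ← mul_assoc, mul_assoc L, hZ.eq, ← mul_assoc, hL]
  have h2 : L (Z (Q v)) = (-1 : ℂ) • L (Z (Q v)) := by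
    have := congrArg (fun A : Module.End ℂ o.Fock => A v) h1
    simp only [Module.End.mul_apply, LinearMap.smul_apply, hv] at this
    exact this
  have h3 : (2 : ℂ) • L (Z (Q v)) = 0 := by
    rw [two_smul]
    nth_rewrite 1 [h2]
    rw [neg_one_smul, neg_add_cancel]
  exact (smul_eq_zero.1 h3).resolve_left two_ne_zero

/-- Three involutions with product i multiply like Pauli matrices. The two forms place the parity of
the side opposite to `d` on the right, where it meets v, or on the left, where it can reach L. -/
theorem parity_triangle_rev {d : D} (h : M.BulkVertex d) :
    o.parity (.typeII d h) =
      Complex.I • (o.parity (.typeII _ h.rot.rot) * o.parity (.typeII _ h.rot)) ∧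
    o.parity (.typeII _ h.rot.rot) =
      Complex.I • (o.parity (.typeII _ h.rot) * o.parity (.typeII d h)) := by
  have key := parity_triangle (o := o) h
  have h0 := parity_mul_self (o := o) (.typeII d h)
  have h1 := parity_mul_self (o := o) (.typeII _ h.rot)
  have h2 := parity_mul_self (o := o) (.typeII _ h.rot.rot)
  revert key h0 h1 h2
  generalize o.parity (.typeII d h) = a
  generalize o.parity (.typeII _ h.rot) = b
  generalize o.parity (.typeII _ h.rot.rot) = c
  intro key h0 h1 h2
  have hab : a * b = Complex.I • c := by
    rw [← mul_one (a * b), ← h2, ← mul_assoc, key, smul_mul_assoc, one_mul]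
  constructor
  · have h3 : a = (Complex.I • c) * b := by rw [← hab, mul_assoc, h1, mul_one]
    rw [h3, smul_mul_assoc]
  · have h3 : b = Complex.I • (a * c) := by
      rw [← mul_smul_comm, ← hab, ← mul_assoc, h0, one_mul]
    have h4 : b * c = Complex.I • a := by
      nth_rewrite 1 [h3]
      rw [smul_mul_assoc, mul_assoc, h2, mul_one]
    have h5 : c * b = (-Complex.I) • a := by
      have : (c * b) * (b * c) = 1 := by rw [mul_assoc, ← mul_assoc b, h1, one_mul, h2]
      rw [h4, mul_smul_comm] at this
      have h6 : Complex.I • (c * b) = a := by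
        rw [← mul_one (c * b), ← h0, ← mul_assoc, ← smul_mul_assoc, this, one_mul]
      rw [← h6, smul_smul]
      simp
    have h7 : b * a = (-Complex.I) • c := by
      have h9 : (c * b) * a = (-Complex.I) • 1 := by rw [h5, smul_mul_assoc, h0]
      rw [← one_mul (b * a), ← h2, mul_assoc, ← mul_assoc c b, h9, mul_smul_comm, mul_one]
    rw [h7, smul_smul]
    simp

theorem commute_parity_of_atVertex {Z : Module.End ℂ o.Fock} {d : D} {e : o.Edge}
    (hZ : ∀ x : M.Majorana, M.AtVertex d x.1 → Commute Z (o.γ x))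
    (he : ∀ x, e.Ends x → M.AtVertex d x.1) : Commute Z (o.parity e) :=
  commute_parity fun x hx => hZ x (he x hx)

/-- At an end of a shared edge, the two orders of the flips differ by a phase. -/
theorem minorEdge_transfer {c : M.Config} {p q : M.Plaquette} {d : D} (h : M.BulkVertex d)
    (hc : c.spin p.1 = c.spin q.1) (hp : M.left d = p.1) (hq : M.left (M.rev d) = q.1)
    {L Z : Module.End ℂ o.Fock} {v : o.Fock}
    (hL : ∀ e ∈ o.dimers ((c.flip p).flip q), L * o.parity e = L)
    (hv : ∀ e ∈ o.dimers c, o.parity e v = v)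
    (hZ : ∀ x : M.Majorana, M.AtVertex d x.1 → Commute Z (o.γ x)) :
    L (Z (o.parity (o.minorEdge (c.flip q) d h) v)) =
      Complex.I • L (Z (o.parity (o.minorEdge (c.flip p) d h) v)) := by
  have hpq : p.1 ≠ q.1 := by rw [← hp, ← hq]; exact (M.left_rev_ne d).symm
  have hr1 := left_rot_ne (M := M) d
  have hr2 := left_rot_ne (M := M) (M.rot d)
  rw [M.left_rev] at hq
  have hrp : M.left (M.rot d) ≠ p.1 := hp ▸ hr1
  have hrq : M.left (M.rot d) ≠ q.1 := hq ▸ hr2.symm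
  obtain ⟨t0, t2⟩ := parity_triangle_rev (o := o) h
  have hcomm : Commute Z (o.parity (.typeII _ h.rot)) := by
    refine commute_parity_of_atVertex hZ fun x hx => ?_
    rw [typeII_ends] at hx
    exact Or.inr hx
  have hmin_q : o.minorEdge (c.flip q) d h =
      if c.spin p.1 = c.spin (M.left (M.rot d)) then .typeII _ h.rot.rot else .typeII d h := by
    rw [minorEdge, hp, Config.spin_flip_of_ne _ _ hpq, Config.spin_flip_of_ne _ _ hrq]
  have hmin_p : o.minorEdge (c.flip p) d h =
      if c.spin p.1 = c.spin (M.left (M.rot d)) then .typeII d h else .typeII _ h.rot.rot := by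
    rw [minorEdge, hp, Config.spin_flip_self, Config.spin_flip_of_ne _ _ hrp]
    by_cases h' : c.spin p.1 = c.spin (M.left (M.rot d))
    · rw [if_pos h', if_neg]; rw [h']; simp
    · rw [if_neg h', if_pos]
      revert h'
      cases c.spin p.1 <;> cases c.spin (M.left (M.rot d)) <;> simp
  rw [hmin_p, hmin_q]
  -- If the third face agrees with p and q, it is in the minority after both flips; otherwise it
  -- already is in c. So the third side of the triangle is absorbed by L in the one case and by v in
  -- the other.
  by_cases h' : c.spin p.1 = c.spin (M.left (M.rot d))
  · rw [if_pos h', if_pos h']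
    have hmem : Edge.typeII _ h.rot ∈ o.dimers ((c.flip p).flip q) := by
      rw [typeII_mem_dimers, M.rot_three, hp, hq, Config.spin_flip_self,
        Config.spin_flip_of_ne _ q hpq, Config.spin_flip_of_ne _ q hrq, Config.spin_flip_self,
        Config.spin_flip_of_ne _ p hpq.symm, Config.spin_flip_of_ne _ p hrp, ← hc, h']
      simp
    rw [t2, LinearMap.smul_apply, map_smul, map_smul, Module.End.mul_apply,
      ← Module.End.mul_apply Z, hcomm.eq, Module.End.mul_apply, ← Module.End.mul_apply L, hL _ hmem]
  · rw [if_neg h', if_neg h']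
    have hmem : Edge.typeII _ h.rot ∈ o.dimers c := by
      rw [typeII_mem_dimers, M.rot_three, hp, hq, ← hc]
      exact ⟨fun h'' => h' h''.symm, fun h'' => h' h''.symm⟩
    rw [t0, LinearMap.smul_apply, map_smul, map_smul, Module.End.mul_apply, hv _ hmem]

theorem proj_apply (e : o.Edge) (v : o.Fock) :
    o.proj e v = (1 / 2 : ℂ) • (v + o.parity e v) := rfl

/-- Both orders of the flips have the same matrix elements at a shared edge. -/
theorem endEdges_transfer {c : M.Config} {p q : M.Plaquette} {d : D}
    (hc : c.spin p.1 = c.spin q.1) (hp : M.left d = p.1) (hq : M.left (M.rev d) = q.1)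
    {L Z : Module.End ℂ o.Fock} {v : o.Fock}
    (hL : ∀ e ∈ o.dimers ((c.flip p).flip q), L * o.parity e = L)
    (hv : ∀ e ∈ o.dimers c, o.parity e v = v)
    (hZ : ∀ x : M.Majorana, M.AtEdge d x.1 → Commute Z (o.γ x)) :
    L (Z (((o.endEdges (c.flip q) d).map o.proj).prod v)) =
      L (Z (((o.endEdges (c.flip p) d).map o.proj).prod v)) := by
  have hb : Between p q d := Or.inl ⟨hp, hq⟩
  obtain ⟨l, hl, hends⟩ := exists_typeI_ends o hb.inner
  have hrr : M.rev (M.rev d) = d := M.rev_rev d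
  have hlc : Edge.typeI l ∈ o.dimers c := by
    rw [typeI_mem_dimers]
    rcases hl with hl | hl <;> rw [hl]
    · exact hb.spin_eq hc
    · exact hb.rev.spin_eq hc
  have hlE : Edge.typeI l ∈ o.dimers ((c.flip p).flip q) := by
    rw [typeI_mem_dimers]
    rcases hl with hl | hl <;> rw [hl]
    · exact hb.spin_eq (spin_flip_flip_eq hb.ne hc)
    · exact hb.rev.spin_eq (spin_flip_flip_eq hb.ne hc)
  have hZl : Commute Z (o.parity (.typeI l)) := commute_parity fun x hx => by
    refine hZ x ?_
    rcases (hends x).1 hx with h | h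
    · exact Or.inl (Or.inl h)
    · exact Or.inr (Or.inl h)
  have hanti : ∀ c' d' (h : M.BulkVertex d'), (d' = d ∨ d' = M.rev d) →
      Anticommute (o.parity (o.minorEdge c' d' h)) (o.parity (.typeI l)) := by
    intro c' d' h hd'
    refine anticommute_parity_parity (x := ⟨d', h.inner⟩) (y := ⟨M.rev d', h.inner.rev⟩) ?_
      (minorEdge_ends_self c' h) fun hx => ?_
    · intro z
      rw [hends z]
      refine Iff.trans ?_ (or_congr Subtype.ext_iff.symm Subtype.ext_iff.symm)
      rcases hd' with rfl | rfl
      · exact Iff.rfl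
      · have hz : z.1 = M.rev (M.rev d) ↔ z.1 = d := by rw [hrr]
        exact or_comm.trans (or_congr Iff.rfl hz.symm)
    · have hb' : Between p q d' := by
        rcases hd' with rfl | rfl
        · exact hb
        · exact hb.rev
      exact hb'.not_atVertex_rev (minorEdge_atVertex hx)
  -- The parity of the shared edge is conserved between v and L, and a single triangle parity
  -- reverses it.
  have hzero : ∀ c' d' (h : M.BulkVertex d'), (d' = d ∨ d' = M.rev d) →
      L (Z (o.parity (o.minorEdge c' d' h) v)) = 0 := fun c' d' h hd' =>
    apply_eq_zero_of_anticommute (hL _ hlE) hZl (hanti c' d' h hd') (hv _ hlc)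
  have hdisj : ∀ x, M.AtVertex d x → ¬ M.AtVertex (M.rev d) x := fun x hx hx' =>
    M.rev_ne d (hb.eq_of_atVertex hb.rev hx hx').symm
  unfold endEdges
  by_cases h1 : M.BulkVertex d <;> by_cases h2 : M.BulkVertex (M.rev d)
  · simp only [h1, h2, dif_pos, List.cons_append, List.nil_append, List.map_cons, List.map_nil,
      List.prod_cons, List.prod_nil, mul_one, Module.End.mul_apply, proj_apply, map_smul, map_add,
      hzero _ d h1 (Or.inl rfl), hzero _ _ h2 (Or.inr rfl), add_zero]
    have hcq : ∀ c' (A : M.Majorana), M.AtVertex d A.1 →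
        Commute (o.parity (o.minorEdge c' _ h2)) (o.γ A) := fun c' A hA =>
      commute_parity_γ fun hx => hdisj _ hA (minorEdge_atVertex hx)
    have hcp : ∀ c' (A : M.Majorana), M.AtVertex (M.rev d) A.1 →
        Commute (o.parity (o.minorEdge c' _ h1)) (o.γ A) := fun c' A hA =>
      commute_parity_γ fun hx => hdisj _ (minorEdge_atVertex hx) hA
    have hswap : ∀ c' c'', Commute (o.parity (o.minorEdge c' d h1))
        (o.parity (o.minorEdge c'' _ h2)) := fun c' c'' =>
      commute_parity fun x hx => hcp c' x (minorEdge_atVertex hx)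
    have s1 := minorEdge_transfer (o := o) (Z := Z * o.parity (o.minorEdge (c.flip q) _ h2)) h1 hc
      hp hq hL hv (fun x hx => (hZ x (Or.inl hx)).mul_left (hcq _ x hx))
    -- The reversed dart has q on its left, so p and q change places: the phase i now stands on the
    -- opposite side and cancels the one of `s1`.
    have s2 := minorEdge_transfer (o := o) (c := c) (p := q) (q := p) (L := L) (v := v)
      (Z := Z * o.parity (o.minorEdge (c.flip p) d h1)) h2 hc.symm hq (by rw [hrr, hp])
      (by rw [Config.flip_comm _ hb.ne.symm]; exact hL) hv
      (fun x hx => (hZ x (Or.inr hx)).mul_left (hcp _ x hx))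
    simp only [Module.End.mul_apply] at s1 s2
    have e1 : ∀ c' c'', o.parity (o.minorEdge c' d h1) (o.parity (o.minorEdge c'' _ h2) v) =
        o.parity (o.minorEdge c'' _ h2) (o.parity (o.minorEdge c' d h1) v) := fun c' c'' => by
      rw [← Module.End.mul_apply, (hswap c' c'').eq, Module.End.mul_apply]
    have key : L (Z (o.parity (o.minorEdge (c.flip q) d h1)
          (o.parity (o.minorEdge (c.flip q) _ h2) v))) =
        L (Z (o.parity (o.minorEdge (c.flip p) d h1)
          (o.parity (o.minorEdge (c.flip p) _ h2) v))) := by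
      rw [e1, s1, ← e1, s2]
    rw [key]
  -- With only one end off the boundary the single parity drops out, leaving the factor 1/2 in both
  -- orders.
  · simp only [h1, h2, dif_pos, dif_neg, not_false_eq_true, List.append_nil, List.map_cons,
      List.map_nil, List.prod_cons, List.prod_nil, mul_one, proj_apply, map_smul, map_add,
      hzero _ d h1 (Or.inl rfl)]
  · simp only [h1, h2, dif_pos, dif_neg, not_false_eq_true, List.nil_append, List.map_cons,
      List.map_nil, List.prod_cons, List.prod_nil, mul_one, proj_apply, map_smul, map_add,
      hzero _ _ h2 (Or.inr rfl)]
  · simp only [h1, h2, dif_neg, not_false_eq_true]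

theorem endProd_commute_γ {c : M.Config} {d : D} {x : M.Majorana} (hx : ¬ M.AtEdge d x.1) :
    Commute ((o.endEdges c d).map o.proj).prod (o.γ x) :=
  (commute_prod_proj fun _ he => commute_proj
    (commute_parity_γ fun h => hx (endEdges_atEdge he h)).symm).symm

/-- Shared edges are exchanged one at a time. The operator `Z` holds the factors at the other edges,
which commute with all Majoranas at the current one; it is therefore general in the induction. -/
theorem prod_endEdges_transfer {c : M.Config} {p q : M.Plaquette} (hc : c.spin p.1 = c.spin q.1)
    {L : Module.End ℂ o.Fock} {v : o.Fock}
    (hL : ∀ e ∈ o.dimers ((c.flip p).flip q), L * o.parity e = L)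
    (hv : ∀ e ∈ o.dimers c, o.parity e v = v) (ds : List D)
    (hds : ∀ d ∈ ds, M.left d = p.1 ∧ M.left (M.rev d) = q.1)
    (hdisj : ds.Pairwise fun d d' => ∀ x, M.AtEdge d x → ¬ M.AtEdge d' x)
    (Z : Module.End ℂ o.Fock)
    (hZ : ∀ d ∈ ds, ∀ x : M.Majorana, M.AtEdge d x.1 → Commute Z (o.γ x)) :
    L (Z ((ds.map fun d => ((o.endEdges (c.flip q) d).map o.proj).prod).prod v)) =
      L (Z ((ds.map fun d => ((o.endEdges (c.flip p) d).map o.proj).prod).prod v)) := by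
  induction ds generalizing Z with
  | nil => rfl
  | cons d ds ih =>
    rw [List.pairwise_cons] at hdisj
    have hd := hds d List.mem_cons_self
    simp only [List.map_cons, List.prod_cons]
    have hcomm : ∀ x : M.Majorana, M.AtEdge d x.1 → Commute
        (ds.map fun d => ((o.endEdges (c.flip p) d).map o.proj).prod).prod (o.γ x) := by
      intro x hx
      refine Commute.list_prod_left _ _ fun A hA => ?_
      obtain ⟨d', hd', rfl⟩ := List.mem_map.1 hA
      exact endProd_commute_γ (hdisj.1 d' hd' x.1 hx)
    have hcomm' : ∀ c', Commute (ds.map fun d => ((o.endEdges (c.flip p) d).map o.proj).prod).prod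
        ((o.endEdges c' d).map o.proj).prod := fun c' =>
      commute_prod_proj fun e he => commute_proj (commute_parity fun x hx =>
        hcomm x (endEdges_atEdge he hx))
    have s1 := ih (fun d' hd' => hds d' (List.mem_cons_of_mem _ hd')) hdisj.2
      (Z * ((o.endEdges (c.flip q) d).map o.proj).prod) fun d' hd' x hx =>
        (hZ d' (List.mem_cons_of_mem _ hd') x hx).mul_left
          (endProd_commute_γ fun hx' => hdisj.1 d' hd' x.1 hx' hx)
    have s2 := endEdges_transfer (o := o) (v := v) hc hd.1 hd.2 hL hv
      (Z := Z * (ds.map fun d => ((o.endEdges (c.flip p) d).map o.proj).prod).prod)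
      fun x hx => (hZ d List.mem_cons_self x hx).mul_left (hcomm x hx)
    simp only [Module.End.mul_apply] at s1 s2 ⊢
    rw [s1, ← Module.End.mul_apply (List.prod _) (List.prod _), ← (hcomm' _).eq,
      Module.End.mul_apply, s2, ← Module.End.mul_apply (List.prod _) (List.prod _), (hcomm' _).eq,
      Module.End.mul_apply]

/-- Flips of two plaquettes with the same spin commute up to normalization. -/
theorem flipProj_flipProj [Fintype D] {c : M.Config} {p q : M.Plaquette} (hpq : p ≠ q)
    (hc : c.spin p.1 = c.spin q.1) {v : o.Fock} (hv : ∀ e ∈ o.dimers c, o.parity e v = v) :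
    o.flipProj p (c.flip q) (o.flipProj q c v) = o.flipProj q (c.flip p) (o.flipProj p c v) := by
  classical
  -- Taking the dart with p on its left lists each shared edge once.
  set ds : List D := (Finset.univ.filter fun d => M.left d = p.1 ∧ M.left (M.rev d) = q.1).toList
    with hds_def
  have hmem : ∀ d, d ∈ ds ↔ M.left d = p.1 ∧ M.left (M.rev d) = q.1 := by simp [hds_def]
  have hds : SharedDarts p q ds := by
    refine ⟨Finset.nodup_toList _, fun d hd => Or.inl ((hmem d).1 hd), fun d hd => ?_,
      fun d hd hd' => ?_⟩
    · rw [hmem, hmem, M.rev_rev]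
      unfold Between at hd
      tauto
    · have h1 := ((hmem _).1 hd).1
      have h2 := ((hmem _).1 hd').1
      exact M.left_rev_ne d (h2.trans h1.symm)
  have hL : ∀ e ∈ o.dimers ((c.flip p).flip q),
      o.dimerProj ((c.flip p).flip q) * o.parity e = o.dimerProj ((c.flip p).flip q) :=
    fun e he => dimerProj_mul_parity he
  rw [flipProj_apply_eq_dimerProj fun e he => parity_flipProj hv he,
    flipProj_apply_eq_dimerProj fun e he => parity_flipProj hv he,
    ← Config.flip_comm c hpq, ← Module.End.mul_apply, ← Module.End.mul_apply,
    mul_flipProj hpq.symm hds.symm hc.symm (by rw [← Config.flip_comm c hpq]; exact hL),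
    mul_flipProj hpq hds hc hL]
  refine prod_endEdges_transfer hc hL hv ds (fun d hd => (hmem d).1 hd) ?_ 1
    fun _ _ _ _ => Commute.one_left _
  exact hds.nodup.pairwise_of_forall_ne fun d hd d' hd' hne x hx hx' =>
    hne (hds.eq_of_atEdge hd hd' hx hx')

end KasteleynOrientation

end OpenCellulation

/-! ### The number of Majoranas on a string. -/

namespace OpenCellulation

variable {D : Type*} {M : OpenCellulation D}

namespace KasteleynOrientation

variable {o : M.KasteleynOrientation}

/-- The corner opposite to `d` at a vertex off the boundary belongs to `p`, and the faces on the two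
sides of `d` have opposite spins. -/
def Opposite (p : M.Plaquette) (c : M.Config) (d : D) : Prop :=
  M.BulkVertex d ∧ M.left (M.rot d) = p.1 ∧
    c.spin (M.left d) ≠ c.spin (M.left (M.rot (M.rot d)))

/-- The Majoranas on the string `𝒟(c) + 𝒟(c_p)`. -/
theorem mem_string {p : M.Plaquette} {c : M.Config} {x : M.Majorana} :
    (∃ e ∈ symmDiff (o.dimers c) (o.dimers (c.flip p)), e.fst = x ∨ e.snd = x) ↔
      (M.left x.1 = p.1 ∨ M.left (M.rev x.1) = p.1) ∨ Opposite p c x.1 := by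
  constructor
  · rintro ⟨e, he, hx⟩
    change e.Ends x at hx
    rw [Set.mem_symmDiff] at he
    cases e with
    | typeI l =>
      left
      rw [typeI_ends] at hx
      have hl : M.left l.1 = p.1 ∨ M.left (M.rev l.1) = p.1 := by
        by_contra hcon
        push Not at hcon
        rw [typeI_mem_dimers, typeI_mem_dimers, Config.spin_flip_of_ne _ _ hcon.1,
          Config.spin_flip_of_ne _ _ hcon.2] at he
        tauto
      rcases hx with hx | hx <;> rw [hx]
      · exact hl
      · rw [M.rev_rev]; exact hl.symm
    | typeII d h =>
      rw [typeII_ends] at hx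
      rw [typeII_mem_dimers, typeII_mem_dimers] at he
      have n1 := left_rot_rot_ne (M := M) d
      have n2 := left_rot_ne (M := M) d
      have n3 := left_rot_ne (M := M) (M.rot d)
      have hc := fun f => Config.spin_flip c p f
      unfold Opposite
      rcases hx with hx | hx <;> rw [hx, M.left_rev]
      · by_cases h0 : M.left d = p.1
        · exact Or.inl (Or.inl h0)
        by_cases h2 : M.left (M.rot (M.rot d)) = p.1
        · exact Or.inl (Or.inr h2)
        have h1 : M.left (M.rot d) = p.1 := by grind
        refine Or.inr ⟨h, h1, fun heq => ?_⟩
        rw [hc, hc, hc, if_neg h0, if_neg h2] at he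
        tauto
      · rw [M.rot_three]
        by_cases h0 : M.left d = p.1
        · exact Or.inl (Or.inr h0)
        by_cases h1 : M.left (M.rot d) = p.1
        · exact Or.inl (Or.inl h1)
        have h2 : M.left (M.rot (M.rot d)) = p.1 := by grind
        refine Or.inr ⟨h.rot, h2, fun heq => ?_⟩
        rw [hc, hc, hc, if_neg h0, if_neg h1] at he
        have := heq.symm
        tauto
  · rintro (h | ⟨h, h1, h2⟩)
    · obtain ⟨l, hl, hends⟩ := exists_typeI_ends o x.2
      refine ⟨.typeI l, ?_, (hends x).2 (Or.inl rfl)⟩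
      rw [Set.mem_symmDiff, typeI_mem_dimers, typeI_mem_dimers]
      have hne := M.left_rev_ne x.1
      have key : (c.flip p).spin (M.left x.1) = (c.flip p).spin (M.left (M.rev x.1)) ↔
          ¬ c.spin (M.left x.1) = c.spin (M.left (M.rev x.1)) := by
        rcases h with h | h
        · rw [h, Config.spin_flip_self, Config.spin_flip_of_ne _ _ (h ▸ hne)]
          cases c.spin p.1 <;> cases c.spin (M.left (M.rev x.1)) <;> simp
        · rw [h, Config.spin_flip_self, Config.spin_flip_of_ne _ _ (h ▸ hne.symm)]
          cases c.spin p.1 <;> cases c.spin (M.left x.1) <;> simp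
      rcases hl with hl | hl <;> rw [hl]
      · tauto
      · rw [M.rev_rev, eq_comm (a := c.spin _), eq_comm (a := (c.flip p).spin _)]
        tauto
    -- The faces beside `x` are opposite, and the spin of p, the third face, decides which is in the
    -- minority; the flip thus toggles the triangle edge in the corner at `x`.
    · refine ⟨.typeII x.1 h, ?_, Or.inl rfl⟩
      have n2 := left_rot_ne (M := M) x.1
      have n3 := left_rot_ne (M := M) (M.rot x.1)
      rw [Set.mem_symmDiff, typeII_mem_dimers, typeII_mem_dimers, h1, Config.spin_flip_self,
        Config.spin_flip_of_ne _ _ (h1 ▸ n2.symm), Config.spin_flip_of_ne _ _ (h1 ▸ n3)]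
      revert h2
      cases c.spin p.1 <;> cases c.spin (M.left x.1) <;>
        cases c.spin (M.left (M.rot (M.rot x.1))) <;> simp

section Finite

variable [Fintype D]

open scoped Classical in
/-- The number of Majoranas on the type I edges of the plaquette `p`. -/
noncomputable def borderCount (p : M.Plaquette) : ℕ :=
  (Finset.univ.filter fun d => M.Inner d ∧ (M.left d = p.1 ∨ M.left (M.rev d) = p.1)).card

open scoped Classical in
/-- The number of the other Majoranas on the string of `p`. -/
noncomputable def oppositeCount (p : M.Plaquette) (c : M.Config) : ℕ :=
  (Finset.univ.filter fun d => Opposite p c d).card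

theorem stringLength_eq (p : M.Plaquette) (c : M.Config) :
    o.stringLength p c = borderCount p + oppositeCount p c := by
  classical
  have hinj : Function.Injective (fun x : M.Majorana => x.1) := Subtype.val_injective
  rw [stringLength, ← Set.ncard_image_of_injective _ hinj, borderCount, oppositeCount,
    ← Finset.card_union_of_disjoint, ← Set.ncard_coe_finset]
  · congr 1
    ext d
    simp only [Set.mem_image, Finset.coe_union, Finset.coe_filter, Finset.mem_univ, true_and,
      Set.mem_union, Set.mem_ofPred_eq, mem_string]
    constructor
    · rintro ⟨x, hx | hx, rfl⟩
      · exact Or.inl ⟨x.2, hx⟩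
      · exact Or.inr hx
    · rintro (hd | hd)
      · exact ⟨⟨d, hd.1⟩, Or.inl hd.2, rfl⟩
      · exact ⟨⟨d, hd.1.inner⟩, Or.inr hd, rfl⟩
  · rw [Finset.disjoint_filter]
    rintro d - ⟨-, hd⟩ ⟨-, hd', -⟩
    rw [M.left_rev] at hd
    rcases hd with hd | hd
    · exact left_rot_ne d (hd'.trans hd.symm)
    · exact left_rot_ne (M.rot d) (hd.trans hd'.symm)

/-- Reversal pairs the two Majoranas of each type I edge, so the parity of a string length comes
from the opposite corners alone. -/
theorem even_borderCount (p : M.Plaquette) : Even (borderCount p) := by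
  classical
  rw [← ZMod.natCast_eq_zero_iff_even, borderCount, Finset.card_eq_sum_ones, Nat.cast_sum]
  refine Finset.sum_involution (fun d _ => M.rev d) (fun _ _ => by decide)
    (fun d _ _ => M.rev_ne d) ?_ (fun d _ => M.rev_rev d)
  intro d hd
  simp only [Finset.mem_filter, Finset.mem_univ, true_and] at hd ⊢
  refine ⟨hd.1.rev, ?_⟩
  rw [M.rev_rev]
  exact hd.2.symm

/-- The two flips exchange the same corners. -/
theorem oppositeCount_flip {p q : M.Plaquette} (hpq : p ≠ q) {c : M.Config}
    (hc : c.spin p.1 = c.spin q.1) :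
    oppositeCount p (c.flip q) + oppositeCount q c =
      oppositeCount q (c.flip p) + oppositeCount p c := by
  classical
  have hpq' : p.1 ≠ q.1 := fun h => hpq (Subtype.ext h)
  -- The two sides agree vertex by vertex but not dart by dart. Summing over the three rotations of
  -- each dart counts every vertex three times, whence the factor 3.
  have hrot : ∀ (p : M.Plaquette) (c : M.Config), 3 * oppositeCount p c =
      ∑ d, ((if Opposite p c d then 1 else 0) + (if Opposite p c (M.rot d) then 1 else 0) +
        (if Opposite p c (M.rot (M.rot d)) then 1 else 0)) := by
    intro p c
    have h1 : oppositeCount p c = ∑ d, if Opposite p c d then 1 else 0 := by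
      rw [oppositeCount, Finset.card_filter]
    have h2 := Equiv.sum_comp M.rot fun d => if Opposite p c d then 1 else 0
    have h3 := Equiv.sum_comp M.rot fun d => if Opposite p c (M.rot d) then 1 else 0
    rw [Finset.sum_add_distrib, Finset.sum_add_distrib, h3, h2, ← h1]
    ring
  have key : 3 * (oppositeCount p (c.flip q) + oppositeCount q c) =
      3 * (oppositeCount q (c.flip p) + oppositeCount p c) := by
    rw [mul_add, mul_add, hrot, hrot, hrot, hrot, ← Finset.sum_add_distrib,
      ← Finset.sum_add_distrib]
    refine Finset.sum_congr rfl fun d _ => ?_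
    have n1 := left_rot_rot_ne (M := M) d
    have n2 := left_rot_ne (M := M) d
    have n3 := left_rot_ne (M := M) (M.rot d)
    unfold Opposite
    by_cases hB : M.BulkVertex d
    · have hB1 := hB.rot
      have hB2 := hB1.rot
      simp only [hB, hB1, hB2, true_and, M.rot_three, Config.spin_flip]
      generalize M.left (M.rot (M.rot d)) = z at *
      generalize M.left (M.rot d) = y at *
      generalize M.left d = x at *
      by_cases hx : x = p.1 <;> by_cases hy : y = p.1 <;> by_cases hz : z = p.1 <;>
      by_cases hx' : x = q.1 <;> by_cases hy' : y = q.1 <;> by_cases hz' : z = q.1 <;>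
      grind
    · have hB1 : ¬ M.BulkVertex (M.rot d) := fun h => hB (by
        have := h.rot.rot; rwa [M.rot_three] at this)
      have hB2 : ¬ M.BulkVertex (M.rot (M.rot d)) := fun h => hB (by
        have := h.rot; rwa [M.rot_three] at this)
      simp only [hB, hB1, hB2, false_and]
  omega

end Finite

end KasteleynOrientation

end OpenCellulation

/-! ### Boundary plaquettes and the ratio of the normalization constants. -/

namespace OpenCellulation

variable {D : Type*} {M : OpenCellulation D}

theorem rot_next (d : D) : M.rot (M.next d) = M.rev d := by
  simp [TrivalentMap.next]

namespace BoundaryEdge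

theorem left_rot_succ (b : M.BoundaryEdge) : M.left (M.rot b.succ.1) = b.plaquette.1 :=
  congrArg M.left (rot_next b.1)

theorem left_rot_rev (b : M.BoundaryEdge) : M.left (M.rot (M.rev b.1)) = b.succ.plaquette.1 := by
  change _ = M.left (M.rev (M.next b.1))
  rw [M.left_rev, rot_next]

theorem eq_of_plaquette_eq {a b : M.BoundaryEdge} (h : a.plaquette.1 = b.plaquette.1) :
    a = b := by
  refine Subtype.ext (M.rev.injective (M.boundary_edge_unique _ _ ?_ ?_ h)) <;> rw [M.rev_rev]
  · exact a.2
  · exact b.2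

/-- The preceding boundary edge. -/
theorem exists_pred (b : M.BoundaryEdge) : ∃ u : M.BoundaryEdge, u.succ = b := by
  have h : M.next (M.rev (M.rot b.1)) = b.1 := by
    simp [TrivalentMap.next, M.rev_rev]
  refine ⟨⟨M.rev (M.rot b.1), ?_⟩, Subtype.ext h⟩
  rw [← M.left_next, h]
  exact b.2

/-- The neighbours of the boundary plaquette `i` on a boundary circle with two edges. -/
theorem left_rot_eq_succ_iff (b : M.BoundaryEdge) :
    M.left (M.rot b.1) = b.succ.plaquette.1 ↔ b.succ.succ.plaquette.1 = b.plaquette.1 := by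
  constructor
  · obtain ⟨u, rfl⟩ := b.exists_pred
    rw [left_rot_succ]
    intro h
    rw [← eq_of_plaquette_eq h]
  · intro h
    have hb := eq_of_plaquette_eq h
    rw [← b.succ.left_rot_succ, hb]

theorem plaquette_ne_succ (b : M.BoundaryEdge) : b.plaquette ≠ b.succ.plaquette := by
  intro h
  have h' : b.plaquette.1 = b.succ.plaquette.1 := congrArg _ h
  rw [← b.left_rot_rev] at h'
  exact left_rot_ne (M.rev b.1) h'.symm

end BoundaryEdge

namespace KasteleynOrientation

variable {o : M.KasteleynOrientation}

/-- A boundary vertex has no triangle, so only the type I edge between the two adjacent boundary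
plaquettes can cover its Majorana. -/
theorem covered_tail_iff {c : M.Config} (b : M.BoundaryEdge) :
    o.Covered c b.tail ↔ c.spin b.plaquette.1 = c.spin (M.left (M.rot b.1)) := by
  have hl : M.left b.tail.1 = b.plaquette.1 := (M.left_rev b.1).symm
  have hr : M.left (M.rev b.tail.1) = M.left (M.rot b.1) := by
    change M.left (M.rev (M.rot (M.rot b.1))) = _
    rw [M.left_rev, M.rot_three]
  rw [← hl, ← hr]
  constructor
  · rintro ⟨e, he, hx⟩
    change e.Ends _ at hx
    cases e with
    | typeI l =>
      rw [typeI_mem_dimers] at he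
      rcases typeI_ends.1 hx with h | h <;> rw [h]
      · exact he
      · rw [M.rev_rev]; exact he.symm
    | typeII d h =>
      exfalso
      have hb := b.2
      rw [← M.rot_three b.1] at hb
      rcases typeII_ends.1 hx with h' | h'
      · change M.rot (M.rot b.1) = d at h'
        rw [h'] at hb
        exact h.2.1 hb
      · change M.rot (M.rot b.1) = M.rot d at h'
        rw [h'] at hb
        exact h.2.2 hb
  · intro h
    obtain ⟨l, hl, hends⟩ := exists_typeI_ends o b.tail.2
    refine ⟨.typeI l, ?_, (hends _).2 (Or.inl rfl)⟩
    rw [typeI_mem_dimers]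
    rcases hl with hl | hl <;> rw [hl]
    · exact h
    · rw [M.rev_rev]; exact h.symm

theorem covered_head_iff {c : M.Config} (b : M.BoundaryEdge) :
    o.Covered c b.head ↔ c.spin b.succ.plaquette.1 = c.spin b.plaquette.1 := by
  rw [← b.left_rot_succ]
  exact covered_tail_iff b.succ

theorem normRatio_eq_rpow (p q : M.Plaquette) (c : M.Config) :
    o.normRatio p q c = (2 : ℝ) ^ (((((o.stringLength p (c.flip q) + 1) / 2 +
      (o.stringLength q c + 1) / 2 : ℕ) : ℝ) - (((o.stringLength q (c.flip p) + 1) / 2 +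
      (o.stringLength p c + 1) / 2 : ℕ) : ℝ)) / 2) := by
  rw [normRatio, normalization, normalization, normalization, normalization,
    ← Real.rpow_add two_pos, ← Real.rpow_add two_pos, ← Real.rpow_sub two_pos]
  congr 1
  rw [Nat.cast_add, Nat.cast_add]
  ring

theorem normalization_pos (p : M.Plaquette) (c : M.Config) : 0 < o.normalization p c :=
  Real.rpow_pos_of_pos two_pos _

section Finite

variable [Fintype D]

/-- The number of domain walls that end on a boundary plaquette away from the boundary has the
parity determined by the two adjacent boundary plaquettes. -/
theorem natCast_oppositeCount (b : M.BoundaryEdge) (c : M.Config) :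
    (oppositeCount b.plaquette c : ZMod 2) =
      (if c.spin b.succ.plaquette.1 then 1 else 0) +
        (if c.spin (M.left (M.rot b.1)) then 1 else 0) := by
  classical
  set s : M.Face → ZMod 2 := fun f => if c.spin f then 1 else 0 with hs
  -- The default spin of a hole matters here: at the two boundary corners only the neighbouring
  -- plaquette contributes.
  have hhole : ∀ f ∈ M.hole, s f = 0 := fun f hf => by simp [hs, Config.spin, hf]
  set C : Finset D := Finset.univ.filter fun d => M.left d = b.plaquette.1 with hC
  have hrr : ∀ d, M.left (M.rot (M.rot d)) = M.left (M.rev d) := fun d => (M.left_rev d).symm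
  -- Around the face, the spin across each edge is counted once at either end of that edge, so the
  -- total vanishes modulo 2.
  have htot : ∑ d ∈ C, (s (M.left (M.rot d)) + s (M.left (M.rev d))) = 0 := by
    have hshift : ∑ d ∈ C, s (M.left (M.rev d)) = ∑ d ∈ C, s (M.left (M.rot d)) := by
      refine Finset.sum_equiv M.next (fun d => ?_) fun d _ => ?_
      · simp only [hC, Finset.mem_filter, Finset.mem_univ, true_and, M.left_next]
      · rw [rot_next]
    rw [Finset.sum_add_distrib, hshift]
    exact CharTwo.add_self_eq_zero _
  have hbulk : (oppositeCount b.plaquette c : ZMod 2) =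
      ∑ d ∈ C with M.BulkVertex d, (s (M.left (M.rot d)) + s (M.left (M.rev d))) := by
    rw [oppositeCount, Finset.card_filter, Nat.cast_sum, Finset.sum_filter, hC, Finset.sum_filter]
    refine Fintype.sum_equiv M.rot _ _ fun d => ?_
    rw [← hrr, M.rot_three]
    have hB : M.BulkVertex (M.rot d) ↔ M.BulkVertex d :=
      ⟨fun h => by have := h.rot.rot; rwa [M.rot_three] at this, fun h => h.rot⟩
    by_cases h1 : M.BulkVertex d <;> by_cases h2 : M.left (M.rot d) = b.plaquette.1 <;>
      simp only [Opposite, hB, h1, h2, hs, true_and, false_and, if_true, if_false, Nat.cast_zero]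
    cases c.spin (M.left d) <;> cases c.spin (M.left (M.rot (M.rot d))) <;> decide
  -- A plaquette has only one boundary edge, so the corners missing from the count are those at its
  -- two ends.
  have hset : C.filter (fun d => ¬ M.BulkVertex d) = {M.rev b.1, M.rot (M.rot b.1)} := by
    ext d
    simp only [hC, Finset.mem_filter, Finset.mem_univ, true_and, Finset.mem_insert,
      Finset.mem_singleton]
    constructor
    · rintro ⟨hd, hB⟩
      have hd0 : M.left d ∉ M.hole := hd ▸ b.plaquette.2
      by_cases h1 : M.left (M.rot d) ∈ M.hole
      · right
        have := BoundaryEdge.eq_of_plaquette_eq (M := M) (a := ⟨M.rot d, h1⟩) (b := b) (by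
          change M.left (M.rev (M.rot d)) = _
          rw [M.left_rev, M.rot_three, hd])
        have h2 : M.rot d = b.1 := congrArg Subtype.val this
        rw [← h2, M.rot_three]
      · left
        have h2 : M.left (M.rev d) ∈ M.hole := by
          by_contra h2
          exact hB ⟨hd0, h1, by rw [hrr]; exact h2⟩
        have := BoundaryEdge.eq_of_plaquette_eq (M := M) (a := ⟨M.rev d, h2⟩) (b := b) (by
          change M.left (M.rev (M.rev d)) = _
          rw [M.rev_rev, hd])
        have h3 : M.rev d = b.1 := congrArg Subtype.val this
        rw [← h3, M.rev_rev]
    · rintro (rfl | rfl)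
      · refine ⟨rfl, fun h => h.inner.2 ?_⟩
        rw [M.rev_rev]; exact b.2
      · refine ⟨hrr _, fun h => h.2.1 ?_⟩
        rw [M.rot_three]; exact b.2
  have hne : M.rev b.1 ≠ M.rot (M.rot b.1) := by
    intro h
    have h1 : M.left (M.rev (M.rot (M.rot b.1))) ∈ M.hole := by rw [← h, M.rev_rev]; exact b.2
    rw [M.left_rev, M.rot_three] at h1
    exact M.hole_corner _ b.2 h1
  rw [← Finset.sum_filter_add_sum_filter_not C M.BulkVertex, ← hbulk, hset,
    Finset.sum_pair hne, M.rev_rev, M.rot_three, hhole _ b.2, b.left_rot_rev, M.left_rev,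
    M.rot_three, add_zero, zero_add] at htot
  exact CharTwo.add_eq_zero.1 htot

theorem even_stringLength_iff (b : M.BoundaryEdge) (c : M.Config) :
    Even (o.stringLength b.plaquette c) ↔
      c.spin b.succ.plaquette.1 = c.spin (M.left (M.rot b.1)) := by
  rw [stringLength_eq, Nat.even_add, iff_true_left (even_borderCount _),
    ← ZMod.natCast_eq_zero_iff_even, natCast_oppositeCount]
  cases c.spin b.succ.plaquette.1 <;> cases c.spin (M.left (M.rot b.1)) <;> decide

theorem stringLength_flip {p q : M.Plaquette} (hpq : p ≠ q) {c : M.Config}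
    (hc : c.spin p.1 = c.spin q.1) :
    o.stringLength p (c.flip q) + o.stringLength q c =
      o.stringLength q (c.flip p) + o.stringLength p c := by
  have := oppositeCount_flip hpq hc
  simp only [stringLength_eq]
  omega

open scoped Classical in
theorem F_apply (p : M.Plaquette) (ψ : o.State) (c : M.Config) :
    o.F p ψ c = o.flipFactor p (c.flip p) (ψ (c.flip p)) := by
  let : Fintype M.Plaquette := Fintype.ofFinite _
  simp only [F, LinearMap.sum_apply, Finset.sum_apply, LinearMap.comp_apply, LinearMap.proj_apply,
    LinearMap.coe_single]
  rw [Finset.sum_eq_single (c.flip p)]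
  · rw [Config.flip_flip, Pi.single_eq_same]
  · intro c' _ hc'
    refine Pi.single_eq_of_ne ?_ _
    rintro rfl
    exact hc' (Config.flip_flip _ _).symm
  · intro h; exact (h (Finset.mem_univ _)).elim

/-- Flips permute the spin configurations, so each component of the result comes from a single
component of `ψ`; a ratio constant on the support becomes a global factor. -/
theorem F_F_eq_smul {p q : M.Plaquette} (hpq : p ≠ q) {ψ : o.State} {r : ℝ}
    (hr : ∀ c, ψ c ≠ 0 → o.normRatio p q c = r)
    (hψ : ∀ c, ψ c ≠ 0 → o.flipProj p (c.flip q) (o.flipProj q c (ψ c)) =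
      o.flipProj q (c.flip p) (o.flipProj p c (ψ c))) :
    o.F p (o.F q ψ) = (r : ℂ) • o.F q (o.F p ψ) := by
  funext c'
  obtain ⟨c, rfl⟩ : ∃ c : M.Config, c' = (c.flip p).flip q :=
    ⟨(c'.flip q).flip p, by rw [Config.flip_flip, Config.flip_flip]⟩
  rw [Pi.smul_apply, F_apply, F_apply, F_apply, F_apply, Config.flip_flip, Config.flip_flip,
    Config.flip_comm c hpq, Config.flip_flip, Config.flip_flip]
  by_cases h0 : ψ c = 0
  · rw [h0]; simp
  · simp only [flipFactor, LinearMap.smul_apply, map_smul, smul_smul]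
    rw [hψ c h0, ← hr c h0, normRatio]
    congr 1
    have h1 := (normalization_pos (o := o) q (c.flip p)).ne'
    have h2 := (normalization_pos (o := o) p c).ne'
    norm_cast
    field_simp

/-- Ratio of the normalization constants in terms of the spins of four consecutive boundary
plaquettes. -/
theorem normRatio_boundary (b : M.BoundaryEdge) {c : M.Config} (hc : o.Covered c b.head) :
    (o.Covered c b.tail → o.Covered c b.succ.head →
      o.normRatio b.plaquette b.succ.plaquette c = 1) ∧
    (¬ o.Covered c b.tail → ¬ o.Covered c b.succ.head →
      o.normRatio b.plaquette b.succ.plaquette c = 1) ∧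
    (¬ o.Covered c b.tail → o.Covered c b.succ.head →
      o.normRatio b.plaquette b.succ.plaquette c = 1 / √2) ∧
    (o.Covered c b.tail → ¬ o.Covered c b.succ.head →
      o.normRatio b.plaquette b.succ.plaquette c = √2) := by
  rw [covered_head_iff] at hc
  rw [covered_tail_iff, covered_head_iff, normRatio_eq_rpow]
  have hne := b.plaquette_ne_succ
  have hlen := stringLength_flip (o := o) hne hc.symm
  have h1 := even_stringLength_iff (o := o) b (c.flip b.succ.plaquette)
  have h2 := even_stringLength_iff (o := o) b.succ c
  have h3 := even_stringLength_iff (o := o) b.succ (c.flip b.plaquette)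
  have h4 := even_stringLength_iff (o := o) b c
  rw [b.left_rot_succ] at h2 h3
  rw [Config.spin_flip_self] at h1 h3
  revert hlen h1 h2 h3 h4
  generalize o.stringLength b.plaquette (c.flip b.succ.plaquette) = L1
  generalize o.stringLength b.succ.plaquette c = L2
  generalize o.stringLength b.succ.plaquette (c.flip b.plaquette) = L3
  generalize o.stringLength b.plaquette c = L4
  intro hlen h1 h2 h3 h4
  -- The rounded-up halves on the two sides differ by at most one, because `L1 + L2 = L3 + L4` and
  -- the parities of `L1` and `L4`, and of `L2` and `L3`, are tied to the same spins.
  have hzero : (L1 + 1) / 2 + (L2 + 1) / 2 = (L3 + 1) / 2 + (L4 + 1) / 2 →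
      (2 : ℝ) ^ (((((L1 + 1) / 2 + (L2 + 1) / 2 : ℕ) : ℝ) -
        (((L3 + 1) / 2 + (L4 + 1) / 2 : ℕ) : ℝ)) / 2) = 1 := fun h => by rw [h]; simp
  have hminus : (L1 + 1) / 2 + (L2 + 1) / 2 + 1 = (L3 + 1) / 2 + (L4 + 1) / 2 →
      (2 : ℝ) ^ (((((L1 + 1) / 2 + (L2 + 1) / 2 : ℕ) : ℝ) -
        (((L3 + 1) / 2 + (L4 + 1) / 2 : ℕ) : ℝ)) / 2) = 1 / √2 := fun h => by
    rw [← h, Nat.cast_add _ 1, Nat.cast_one, sub_add_cancel_left, Real.sqrt_eq_rpow,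
      neg_div, Real.rpow_neg two_pos.le, one_div (_ ^ _)]
  have hplus : (L1 + 1) / 2 + (L2 + 1) / 2 = (L3 + 1) / 2 + (L4 + 1) / 2 + 1 →
      (2 : ℝ) ^ (((((L1 + 1) / 2 + (L2 + 1) / 2 : ℕ) : ℝ) -
        (((L3 + 1) / 2 + (L4 + 1) / 2 : ℕ) : ℝ)) / 2) = √2 := fun h => by
    rw [h, Nat.cast_add _ 1, Nat.cast_one, add_sub_cancel_left, Real.sqrt_eq_rpow]
  rw [Nat.even_iff] at h1 h2 h3 h4
  revert hzero hminus hplus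
  generalize (2 : ℝ) ^ (((((L1 + 1) / 2 + (L2 + 1) / 2 : ℕ) : ℝ) -
    (((L3 + 1) / 2 + (L4 + 1) / 2 : ℕ) : ℝ)) / 2) = R
  generalize 1 / √2 = y
  generalize √2 = y'
  intro hzero hminus hplus
  -- On a circle with two plaquettes both neighbours of each coincide: all four lengths are even,
  -- and both outer Majoranas are paired.
  by_cases hloop : M.left (M.rot b.1) = b.succ.plaquette.1
  · have hloop' := b.left_rot_eq_succ_iff.1 hloop
    rw [hloop, Config.spin_flip_self] at h1
    rw [hloop', Config.spin_flip_self] at h3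
    rw [hloop] at h4 ⊢
    rw [hloop'] at h2 ⊢
    simp only [iff_true] at h1 h2 h3 h4
    refine ⟨fun _ _ => hzero (by omega), fun h => (h hc.symm).elim, fun h => (h hc.symm).elim,
      fun _ h => (h hc.symm).elim⟩
  · have hloop' := fun h => hloop (b.left_rot_eq_succ_iff.2 h)
    rw [Config.spin_flip_of_ne _ _ hloop] at h1
    rw [Config.spin_flip_of_ne _ _ hloop'] at h3
    rw [hc] at h1 h4 ⊢
    revert h1 h2 h3 h4
    cases c.spin b.plaquette.1 <;> cases c.spin (M.left (M.rot b.1)) <;>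
      cases c.spin b.succ.succ.plaquette.1 <;> simp <;> intros <;>
      first | exact hzero (by omega) | exact hminus (by omega) | exact hplus (by omega)

end Finite

end KasteleynOrientation

end OpenCellulation

/-! ### The four boundary cases. -/

open OpenCellulation OpenCellulation.KasteleynOrientation

theorem proposition3 {D : Type*} [Fintype D] (M : OpenCellulation D)
    (o : M.KasteleynOrientation) (b : M.BoundaryEdge) (i j : M.Plaquette)
    (hi : i = b.plaquette) (hj : j = b.succ.plaquette)
    (ψ : o.State) (hψ : ψ ∈ o.constrained) (hpaired : o.Paired ψ b.head) :
    (o.Paired ψ b.tail → o.Paired ψ b.succ.head →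
      o.F i (o.F j ψ) = o.F j (o.F i ψ) ∧
      ∀ c, ψ c ≠ 0 → o.normRatio i j c = 1) ∧
    (o.Unpaired ψ b.tail → o.Unpaired ψ b.succ.head →
      o.F i (o.F j ψ) = o.F j (o.F i ψ) ∧
      ∀ c, ψ c ≠ 0 → o.normRatio i j c = 1) ∧
    (o.Unpaired ψ b.tail → o.Paired ψ b.succ.head →
      o.F i (o.F j ψ) = ((1 / √2 : ℝ) : ℂ) • o.F j (o.F i ψ) ∧
      ∀ c, ψ c ≠ 0 → o.normRatio i j c = 1 / √2) ∧
    (o.Paired ψ b.tail → o.Unpaired ψ b.succ.head →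
      o.F j (o.F i ψ) = ((1 / √2 : ℝ) : ℂ) • o.F i (o.F j ψ) ∧
      ∀ c, ψ c ≠ 0 → o.normRatio i j c = √2) ∧
    (∀ c, ψ c ≠ 0 →
      o.flipProj i (c.flip j) (o.flipProj j c (ψ c)) =
        o.flipProj j (c.flip i) (o.flipProj i c (ψ c))) := by
  subst hi hj
  have hne := b.plaquette_ne_succ
  have hproj : ∀ c, ψ c ≠ 0 →
      o.flipProj b.plaquette (c.flip b.succ.plaquette) (o.flipProj b.succ.plaquette c (ψ c)) =
        o.flipProj b.succ.plaquette (c.flip b.plaquette) (o.flipProj b.plaquette c (ψ c)) :=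
    fun c hc => flipProj_flipProj hne ((covered_head_iff b).1 (hpaired c hc)).symm (hψ c)
  have hF := fun r (hr : ∀ c, ψ c ≠ 0 → o.normRatio b.plaquette b.succ.plaquette c = r) =>
    F_F_eq_smul (o := o) hne hr hproj
  refine ⟨fun ht hh => ?_, fun ht hh => ?_, fun ht hh => ?_, fun ht hh => ?_, hproj⟩
  · have hr := fun c hc => (normRatio_boundary b (hpaired c hc)).1 (ht c hc) (hh c hc)
    exact ⟨by simpa using hF 1 hr, hr⟩
  · have hr := fun c hc => (normRatio_boundary b (hpaired c hc)).2.1 (ht c hc) (hh c hc)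
    exact ⟨by simpa using hF 1 hr, hr⟩
  · have hr := fun c hc => (normRatio_boundary b (hpaired c hc)).2.2.1 (ht c hc) (hh c hc)
    exact ⟨hF _ hr, hr⟩
  · have hr := fun c hc => (normRatio_boundary b (hpaired c hc)).2.2.2 (ht c hc) (hh c hc)
    refine ⟨?_, hr⟩
    rw [hF _ hr, smul_smul, ← Complex.ofReal_mul, one_div, inv_mul_cancel₀ (by positivity),
      Complex.ofReal_one, one_smul]
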